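/- **Gluings of polygons.** Consider an oriented polygon with $M\ge 1$ sides. A *gluing* of it is a choice of disjoint pairs of sides; the two sides of each pair are identified so that the result is an oriented surface, and the remaining sides stay unglued. The resulting surface has a genus $g$ and a certain number $L$ of boundary components, each carrying a number $n\ge 0$ of unglued sides; a vertex in the interior of the glued surface counts as a boundary component with $n=0$ sides (a punctured point). For $g\ge 0$, $L\ge 1$ and $n_1,\dots,n_L\ge 0$, not all zero, let $\mathcal N_{g,L}(n_1,\dots,n_L)$ be the number of gluings of polygons (with any number of sides, necessarily $M=n_1+\dots+n_L+4g+2L-2$) that produce a surface of genus $g$ with $L$ boundary components having $n_1,\dots,n_L$ sides. Here the unglued sides carry pairwise different prescribed letters, in a prescribed cyclic order on each boundary component, the punctured points are indistinguishable, and gluings that differ by a rotation of the polygon are identified. **Harer–Zagier numbers.** For $g,N\ge 0$ let $\epsilon_g(N)$ be the number of ways to glue all sides of an oriented $2N$-gon with a distinguished vertex in pairs so as to produce a closed oriented surface of genus $g$ (no rotations are divided out; the $0$-gon is taken to give the sphere, so $\epsilon_0(0)=1$). **Statement.** 1. For all $g\ge 0$ and $L\ge 1$, $$\mathcal N_{g,L}(1,0,\dots,0)=\epsilon_g(2g+L-1).$$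 2. For all $g\ge 0$ and $N\ge 2g$, with $L=N-2g+1$, $$\epsilon_g(N)=\frac{1}{4^g}\cdot\frac{(2N)!}{(N-2g+1)!\,N!}\sum_{\lambda_1+\dots+\lambda_L=g}\frac{1}{(2\lambda_1+1)\cdots(2\lambda_L+1)},$$ where the sum is over all ordered $L$-tuples of non-negative integers with sum $g$. 3. For all complex $x,y$ with $|x|<1$, $$1+2\sum_{g=0}^{\infty}\sum_{N=2g}^{\infty}\epsilon_g(N)\,\frac{x^{N+1}y^{N-2g+1}}{(2N-1)!!}=\left(\frac{1+x}{1-x}\right)^{y},$$ where the double series converges absolutely, $(-1)!!=1$, and the power is $\exp\bigl(y\operatorname{Log}\frac{1+x}{1-x}\bigr)$ with the principal logarithm. -/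

import Mathlib

namespace PolygonGluing

/-- The rotation `s ↦ s + 1` (cyclically) of the sides of an `M`-gon.  The sides are numbered
`0, …, M - 1` along the oriented boundary, and side `s` runs from corner `s` to corner `s + 1`. -/
def rot (M : ℕ) : Equiv.Perm (Fin M) := finRotate M

/-- A pairing `p` of sides is an involution: `{s, p s}` with `p s ≠ s` is a pair of sides that are
glued, and `p s = s` says that `s` stays unglued.  In an orientable gluing the initial corner of `s`
becomes the final corner of `p s`, hence the initial corner of the side `p s + 1`; and an unglued
side `s` ends in the initial corner of `s + 1 = p s + 1`.  So iterating `s ↦ p s + 1` one walks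
along a boundary component of the glued surface, moving along each unglued side that one meets and
turning about the end point at each glued one. -/
def walk {M : ℕ} (p : Equiv.Perm (Fin M)) : Equiv.Perm (Fin M) := rot M * p

/-- The boundary components (holes) of the glued surface are the cycles of the walk.  A cycle that
meets `n` unglued sides is an `n`-gonal hole; for `n = 0` it is an interior vertex, which counts
as a punctured point (a `0`-gon). -/
def Hole {M : ℕ} (p : Equiv.Perm (Fin M)) : Type :=
  Quotient (Equiv.Perm.SameCycle.setoid (walk p))

/-- The number of glued pairs of sides, each pair being counted at its smaller side. -/
noncomputable def numPairs {M : ℕ} (p : Equiv.Perm (Fin M)) : ℕ := Nat.card {s : Fin M // s < p s}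

/-- The surface glued from a polygon has genus `g`.  When each hole is closed up to a single point,
the surface becomes a closed one, decomposed into one vertex for each hole, one edge for each glued
pair of sides, and one face; its Euler characteristic is `2 - 2 g`. -/
def HasGenus {M : ℕ} (p : Equiv.Perm (Fin M)) (g : ℕ) : Prop :=
  (Nat.card (Hole p) : ℤ) - numPairs p + 1 = 2 - 2 * g

/-- A gluing of an `M`-gon to an oriented surface of genus `g` with `L` polygonal boundary
components of `n 0, …, n (L - 1)` sides, on which a sequence of distinct letters `(i, k)`, with
`i < L` and `k < n i`, is prescribed: the letters of the `i`-th component are, in cyclic order,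
`(i, 0), (i, 1), …, (i, n i - 1)`.  The repeated letters of the word along the polygon matter only
through the pairing `side` of equal letters; the letter `(i, k)` stands at the side
`letter ⟨i, k⟩`.  The punctured points carry no names. -/
@[ext]
structure Gluing (g : ℕ) {L : ℕ} (n : Fin L → ℕ) (M : ℕ) where
  /-- the pairing of the sides -/
  side : Equiv.Perm (Fin M)
  /-- the position of each non-repeated letter -/
  letter : (Σ i : Fin L, Fin (n i)) → Fin M
  side_side : ∀ s, side (side s) = s
  letter_injective : Function.Injective letter
  unglued_iff : ∀ s, side s = s ↔ ∃ x, letter x = s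
  /-- along the boundary, the next unglued side after the one with the letter `(i, k)` is the one
  with the letter `(i, k + 1)`, where `k + 1` is read cyclically -/
  next_letter : ∀ (i : Fin L) (k : Fin (n i)), ∃ m : ℕ, 0 < m ∧
    (walk side ^ m) (letter ⟨i, k⟩) = letter ⟨i, finRotate (n i) k⟩ ∧
    ∀ j : ℕ, 0 < j → j < m →
      side ((walk side ^ j) (letter ⟨i, k⟩)) ≠ (walk side ^ j) (letter ⟨i, k⟩)
  /-- in total there are `L` holes, so those without sides are as many as the `i` with `n i = 0` -/
  card_hole : Nat.card (Hole side) = L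
  genus : HasGenus side g

/-- Two gluings of the `M`-gon are equivalent if a rotation of the polygon takes the one to the
other. -/
def Gluing.rotSetoid (g : ℕ) {L : ℕ} (n : Fin L → ℕ) (M : ℕ) : Setoid (Gluing g n M) where
  r G H := ∃ k : ℤ, H.side = rot M ^ k * G.side * (rot M ^ k)⁻¹ ∧
    ∀ x, H.letter x = (rot M ^ k) (G.letter x)
  iseqv :=
    { refl := fun G => ⟨0, by simp, by simp⟩
      symm := by
        rintro G H ⟨k, h1, h2⟩
        refine ⟨-k, ?_, fun x => ?_⟩
        · rw [h1]; group
        · rw [h2, ← Equiv.Perm.mul_apply, ← zpow_add]; simp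
      trans := by
        rintro G H K ⟨k, h1, h2⟩ ⟨l, h3, h4⟩
        refine ⟨l + k, ?_, fun x => ?_⟩
        · rw [h3, h1]; group
        · rw [h4, h2, zpow_add, Equiv.Perm.mul_apply] }

/-- `𝒩_{g,L}(n₁, …, n_L)`: the number of equivalence classes of gluings of polygons (with any
number of sides) to a surface of genus `g` with `L` polygonal boundary components of
`n₁, …, n_L` sides. -/
noncomputable def numGluings (g : ℕ) {L : ℕ} (n : Fin L → ℕ) : ℕ :=
  Nat.card (Σ M : ℕ, Quotient (Gluing.rotSetoid g n M))

/-- The vertices of the closed surface obtained from a `2N`-gon by gluing side `s` to side `p s`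
for all `s`.  The corners met along the boundary, from the distinguished corner back to itself, are
`0, …, 2N`; the corners `0` and `2N` are the same, and gluing identifies the initial corner `s` of
the side `s` with the final corner `p s + 1` of the side `p s`.  For `N = 0` there is one corner,
and the surface is a sphere with one vertex. -/
def Vertex {N : ℕ} (p : Equiv.Perm (Fin (2 * N))) : Type :=
  Quot fun a b : Fin (2 * N + 1) =>
    (a = 0 ∧ b = Fin.last (2 * N)) ∨ ∃ s : Fin (2 * N), a = s.castSucc ∧ b = (p s).succ

/-- The Harer–Zagier number `ε_g(N)`: the number of ways to glue all sides of a `2N`-gon with a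
distinguished corner in pairs so as to obtain a closed oriented surface of genus `g`, that is, one
whose Euler characteristic (vertices) - `N` + 1 is `2 - 2 g`. -/
noncomputable def harerZagier (g N : ℕ) : ℕ :=
  Nat.card {p : Equiv.Perm (Fin (2 * N)) // (∀ s, p (p s) = s) ∧ (∀ s, p s ≠ s) ∧
    (Nat.card (Vertex p) : ℤ) - N + 1 = 2 - 2 * g}

/-- The sequence `(1, 0, …, 0)` of length `L`. -/
def oneZeros (L : ℕ) : Fin L → ℕ := fun i => if (i : ℕ) = 0 then 1 else 0

end PolygonGluing

/-! The vertices of a glued `2N`-gon are the cycles of `c * p`, where `c` is the rotation of `2N +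
1` elements and the pairing `p` is extended by one fixed point (`card_vertex`). So everything
follows from the polynomial `∑ p, y ^ cyc (c * p)` over all pairings. Conjugation turns it, up to a
constant, into a sum with `p` fixed over all `w` with a single cycle (`sum_matchings_pow_cyc`).

To drop the condition on `w`, one sums `(-1) ^ (number of cycles in A)` over the `w`-invariant sets
`A` avoiding a base point: this gives `1` if `w` is a single cycle and `0` otherwise
(`sum_invariant_sets`). After exchanging the sums, `w` runs freely over the permutations of `A`
times those of its complement. A sign-reversing involution kills every `A` that cuts two or more
pairs of `p` (`weight_eq_zero`). For the other `A` the sum factors into a falling and a rising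
factorial (`weight_mul`, `weight_mul_swap`).

The resulting alternating sum is, up to factorials, the coefficient of `X ^ (N + 1)` in `(1 - X) ^
(-y) * (2 - X) ^ N`. Twice this coefficient is that of `((1 + X) / (1 - X)) ^ y = exp (2 y artanh
X)` (`two_mul_coeff_geom`, `coeff_geom_pow_mul`). Since `artanh X = ∑ X ^ (2k + 1) / (2k + 1)`, the
coefficient of `y ^ L` with `L = N - 2g + 1` is the closed formula, and summing over all `L` and `g`
gives the generating function.

For the first statement, a gluing with one unglued side has a unique rotation that makes this side
the last one; shrinking it to the distinguished corner leaves a complete gluing of a `2N`-gon. -/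

namespace PolygonGluing

/-! ### Counting cycles of permutations. -/

open Equiv Equiv.Perm

/-- The number of cycles of a permutation, fixed points included. -/
noncomputable def cyc {α : Type*} (σ : Perm α) : ℕ := Nat.card (Quotient (SameCycle.setoid σ))

theorem zpow_semiconj {α β : Type*} {σ : Perm α} {τ : Perm β} (e : α → β)
    (h : ∀ x, e (σ x) = τ (e x)) (k : ℤ) (x : α) : e ((σ ^ k) x) = (τ ^ k) (e x) := by
  induction k using Int.induction_on generalizing x with
  | zero => simp
  | succ n ih => rw [zpow_add_one, zpow_add_one, Perm.mul_apply, Perm.mul_apply, ih, h]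
  | pred n ih =>
    rw [zpow_sub_one, zpow_sub_one, Perm.mul_apply, Perm.mul_apply, ih]
    congr 1
    rw [Perm.eq_inv_iff_eq, ← h]; simp

theorem sameCycle_of_semiconj {α β : Type*} {σ : Perm α} {τ : Perm β} (e : α → β)
    (h : ∀ x, e (σ x) = τ (e x)) {x y : α} (hxy : SameCycle σ x y) : SameCycle τ (e x) (e y) := by
  obtain ⟨k, rfl⟩ := hxy
  exact ⟨k, (zpow_semiconj e h k x).symm⟩

theorem sameCycle_semiconj_iff {α β : Type*} {σ : Perm α} {τ : Perm β} (e : α → β)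
    (he : Function.Injective e)
    (h : ∀ x, e (σ x) = τ (e x)) {x y : α} : SameCycle τ (e x) (e y) ↔ SameCycle σ x y := by
  refine ⟨?_, sameCycle_of_semiconj e h⟩
  rintro ⟨k, hk⟩
  exact ⟨k, he (by rw [zpow_semiconj e h, hk])⟩

theorem cyc_congr {α β : Type*} {σ : Perm α} {τ : Perm β} (e : α ≃ β)
    (h : ∀ x, e (σ x) = τ (e x)) : cyc σ = cyc τ :=
  Nat.card_congr (Quotient.congr e fun _ _ => (sameCycle_semiconj_iff e e.injective h).symm)

theorem cyc_conj {α : Type*} (σ τ : Perm α) : cyc (τ * σ * τ⁻¹) = cyc σ :=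
  (cyc_congr τ (by simp)).symm

theorem cyc_inv {α : Type*} (σ : Perm α) : cyc σ⁻¹ = cyc σ := by
  refine Nat.card_congr (Quotient.congr (Equiv.refl _) fun _ _ => ?_)
  exact sameCycle_inv

/-- A function that is unchanged along a permutation is constant on its cycles. -/
theorem SameCycle.map_eq {α β : Type*} {σ : Perm α} {f : α → β} (hf : ∀ x, f (σ x) = f x)
    {x y : α} (h : SameCycle σ x y) : f x = f y := by
  obtain ⟨k, rfl⟩ := h
  have := zpow_semiconj (τ := (1 : Perm β)) f (by simpa using hf) k x
  simpa using this.symm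

/-- Starting from `a`, the product follows the `σ`-orbit of `b`. Before its first return to `b` this
orbit meets neither `a` nor `b`, so the transposition does not interfere. -/
theorem sameCycle_mul_swap {α : Type*} [Finite α] [DecidableEq α] {σ : Perm α} {a b : α}
    (h : ¬ SameCycle σ a b) : SameCycle (σ * swap a b) a b := by
  have hex : ∃ n : ℕ, 0 < n ∧ (σ ^ n) b = b :=
    ⟨orderOf σ, orderOf_pos σ, by simp [pow_orderOf_eq_one]⟩
  classical
  set n := Nat.find hex with hn
  obtain ⟨hn0, hnb⟩ := Nat.find_spec hex
  have key : ∀ k, k + 1 ≤ n → ((σ * swap a b) ^ (k + 1)) a = (σ ^ (k + 1)) b := by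
    intro k
    induction k with
    | zero => intro _; simp
    | succ k ih =>
      intro hk
      have h1 : (σ ^ (k + 1)) b ≠ b := fun hb => Nat.find_min hex (m := k + 1) (by omega) ⟨by omega, hb⟩
      have h2 : (σ ^ (k + 1)) b ≠ a := fun ha => h (SameCycle.symm ⟨((k + 1 : ℕ) : ℤ), by rw [zpow_natCast]; exact ha⟩)
      rw [pow_succ' _ (k + 1), Perm.mul_apply, ih (by omega), Perm.mul_apply,
        swap_apply_of_ne_of_ne h2 h1, ← Perm.mul_apply, ← pow_succ']
  refine ⟨(n : ℤ), ?_⟩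
  have := key (n - 1) (by omega)
  rw [Nat.sub_add_cancel hn0] at this
  rw [zpow_natCast, this, hnb]

/-- Multiplication by a transposition of elements of different cycles merges these two cycles. -/
theorem cyc_mul_swap {α : Type*} [Finite α] [DecidableEq α] {σ : Perm α} {a b : α}
    (h : ¬ SameCycle σ a b) : cyc (σ * swap a b) + 1 = cyc σ := by
  classical
  set τ := σ * swap a b with hτ
  have hab : SameCycle τ a b := sameCycle_mul_swap h
  have hτa : τ a = σ b := by simp [hτ]
  have hτb : τ b = σ a := by simp [hτ]
  have hστ : ∀ x y, SameCycle σ x y → SameCycle τ x y := by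
    intro x y hxy
    refine Quotient.exact (s := SameCycle.setoid τ)
      (SameCycle.map_eq (f := fun z => (Quotient.mk (SameCycle.setoid τ) z)) (fun z => ?_) hxy)
    refine Quotient.sound (s := SameCycle.setoid τ) ?_
    change SameCycle τ (σ z) z
    by_cases hza : z = a
    · rw [hza, ← hτb, sameCycle_apply_left]; exact hab.symm
    by_cases hzb : z = b
    · rw [hzb, ← hτa, sameCycle_apply_left]; exact hab
    have : σ z = τ z := by simp [hτ, swap_apply_of_ne_of_ne hza hzb]
    rw [this, sameCycle_apply_left]
  have hτσ : ∀ x y, SameCycle τ x y → ¬ SameCycle σ x b → ¬ SameCycle σ y b → SameCycle σ x y := by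
    intro x y hxy hx hy
    have := SameCycle.map_eq (f := fun z => if SameCycle σ z b then (Quotient.mk (SameCycle.setoid σ) a)
      else (Quotient.mk (SameCycle.setoid σ) z)) (fun z => ?_) hxy
    · simp only [hx, hy, if_false] at this
      exact Quotient.exact (s := SameCycle.setoid σ) this
    · by_cases hza : z = a
      · simp only [hza, hτa, h, if_false, sameCycle_apply_left, SameCycle.refl, if_true]
      by_cases hzb : z = b
      · simp [hzb, hτb, h, SameCycle.refl]
        exact Quotient.sound (s := SameCycle.setoid σ) (sameCycle_apply_left.2 (SameCycle.refl _ _))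
      have : τ z = σ z := by simp [hτ, swap_apply_of_ne_of_ne hza hzb]
      simp only [this, sameCycle_apply_left]
      split_ifs
      · rfl
      · exact Quotient.sound (s := SameCycle.setoid σ) (sameCycle_apply_left.2 (SameCycle.refl _ _))
  let q : Quotient (SameCycle.setoid σ) := Quotient.mk _ b
  have hcard : Nat.card {r : Quotient (SameCycle.setoid σ) // r ≠ q} = cyc τ := by
    refine Nat.card_congr (Equiv.ofBijective (fun r =>
      Quotient.map (sa := SameCycle.setoid σ) (sb := SameCycle.setoid τ) id hστ r.1) ⟨?_, ?_⟩)
    · rintro ⟨r, hr⟩ ⟨s, hs⟩ hrs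
      induction r using Quotient.inductionOn with | _ r
      induction s using Quotient.inductionOn with | _ s
      refine Subtype.ext (Quotient.sound (s := SameCycle.setoid σ) (hτσ r s ?_ ?_ ?_))
      · exact Quotient.exact (s := SameCycle.setoid τ) hrs
      · exact fun hh => hr (Quotient.sound (s := SameCycle.setoid σ) hh)
      · exact fun hh => hs (Quotient.sound (s := SameCycle.setoid σ) hh)
    · intro s
      induction s using Quotient.inductionOn with | _ s
      by_cases hs : SameCycle σ s b
      · exact ⟨⟨Quotient.mk _ a, fun hh => h (Quotient.exact (s := SameCycle.setoid σ) hh)⟩,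
          Quotient.sound (s := SameCycle.setoid τ) (hab.trans (hστ _ _ hs).symm)⟩
      · exact ⟨⟨Quotient.mk _ s, fun hh => hs (Quotient.exact (s := SameCycle.setoid σ) hh)⟩, rfl⟩
  rw [← hcard, cyc, Nat.card_congr (Equiv.optionSubtypeNe q).symm, Finite.card_option]

theorem cyc_sumCongr {α β : Type*} [Finite α] [Finite β] (σ : Perm α) (τ : Perm β) :
    cyc (Equiv.sumCongr σ τ) = cyc σ + cyc τ := by
  rw [cyc, cyc, cyc, ← Nat.card_sum]
  have hl : ∀ x y, SameCycle (Equiv.sumCongr σ τ) (Sum.inl x) (Sum.inl y) ↔ SameCycle σ x y :=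
    fun x y => sameCycle_semiconj_iff (σ := σ) Sum.inl Sum.inl_injective (by simp)
  have hr : ∀ x y, SameCycle (Equiv.sumCongr σ τ) (Sum.inr x) (Sum.inr y) ↔ SameCycle τ x y :=
    fun x y => sameCycle_semiconj_iff (σ := τ) Sum.inr Sum.inr_injective (by simp)
  have hlr : ∀ x y, ¬ SameCycle (Equiv.sumCongr σ τ) (Sum.inl x) (Sum.inr y) := by
    intro x y hxy
    have := SameCycle.map_eq (f := Sum.isLeft) (by rintro (z | z) <;> simp) hxy
    simp at this
  symm
  refine Nat.card_congr (Equiv.ofBijective (Sum.elim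
    (Quotient.map (sa := SameCycle.setoid σ) (sb := SameCycle.setoid (Equiv.sumCongr σ τ)) Sum.inl
      fun x y h => (hl x y).2 h)
    (Quotient.map (sa := SameCycle.setoid τ) (sb := SameCycle.setoid (Equiv.sumCongr σ τ)) Sum.inr
      fun x y h => (hr x y).2 h)) ⟨?_, ?_⟩)
  · rintro (a | a) (b | b) hab <;> induction a using Quotient.inductionOn with | _ a <;>
      induction b using Quotient.inductionOn with | _ b <;>
      have hab := Quotient.exact (s := SameCycle.setoid (Equiv.sumCongr σ τ)) hab
    · exact congrArg _ (Quotient.sound (s := SameCycle.setoid σ) ((hl _ _).1 hab))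
    · exact absurd hab (hlr _ _)
    · exact absurd (SameCycle.symm hab) (hlr _ _)
    · exact congrArg _ (Quotient.sound (s := SameCycle.setoid τ) ((hr _ _).1 hab))
  · intro s
    induction s using Quotient.inductionOn with | _ s
    rcases s with s | s
    · exact ⟨Sum.inl (Quotient.mk _ s), rfl⟩
    · exact ⟨Sum.inr (Quotient.mk _ s), rfl⟩

theorem cyc_subtypeCongr {α : Type*} [Finite α] (P : α → Prop) [DecidablePred P]
    (σ : Perm {a // P a}) (τ : Perm {a // ¬ P a}) :
    cyc (Perm.subtypeCongr σ τ) = cyc σ + cyc τ := by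
  rw [← cyc_sumCongr]
  refine (cyc_congr (Equiv.sumCompl P) ?_).symm
  rintro (x | x) <;> simp

theorem cyc_unique {α : Type*} [Unique α] (σ : Perm α) : cyc σ = 1 := by
  have : Unique (Quotient (SameCycle.setoid σ)) := Quotient.instUniqueQuotient (SameCycle.setoid σ)
  exact Nat.card_unique

theorem cyc_empty {α : Type*} [IsEmpty α] (σ : Perm α) : cyc σ = 0 := by
  have : IsEmpty (Quotient (SameCycle.setoid σ)) := ⟨fun q => q.inductionOn fun a => isEmptyElim a⟩
  exact Nat.card_of_isEmpty

theorem cyc_optionCongr {α : Type*} [Finite α] (σ : Perm α) : cyc σ.optionCongr = cyc σ + 1 := by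
  rw [← cyc_unique (1 : Perm Unit), ← cyc_sumCongr]
  refine cyc_congr (Equiv.optionEquivSumPUnit.{0} α) ?_
  rintro (_ | x) <;> simp

/-- Up to inversion, the transposition merges the fixed point `none` into the cycle of `i`, which
undoes the extra cycle of `optionCongr`. -/
theorem cyc_swap_mul_optionCongr {α : Type*} [Finite α] [DecidableEq α] (σ : Perm α) (i : α) :
    cyc (swap none (some i) * σ.optionCongr) = cyc σ := by
  have h1 : (swap none (some i) * σ.optionCongr) = (σ⁻¹.optionCongr * swap none (some i))⁻¹ := by
    rw [mul_inv_rev, swap_inv]; rfl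
  have h2 : ¬ SameCycle σ⁻¹.optionCongr none (some i) := by
    intro h
    have := SameCycle.map_eq (f := Option.isSome) (by rintro (_ | z) <;> simp) h
    simp at this
  have := cyc_mul_swap h2
  rw [cyc_optionCongr, cyc_inv] at this
  rw [h1, cyc_inv]
  omega

/-- Induction on the size: a new element is either a cycle of its own, which changes the exponent by
two and keeps the sign, or is inserted into a cycle by a transposition, which changes both. -/
theorem sign_eq_neg_one_pow {α : Type} [Fintype α] [DecidableEq α] (σ : Perm α) :
    ((sign σ : ℤˣ) : ℤ) = (-1) ^ (Fintype.card α + cyc σ) := by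
  classical
  suffices ∀ σ : Perm α, ((sign σ : ℤˣ) : ℤ) = (-1) ^ (Fintype.card α + cyc σ) from this σ
  clear σ
  revert ‹DecidableEq α›
  refine Fintype.induction_empty_option (P := fun α _ => ∀ [DecidableEq α], ∀ σ : Perm α,
    ((sign σ : ℤˣ) : ℤ) = (-1) ^ (Fintype.card α + cyc σ)) ?_ ?_ ?_ α
  · intro α β _ e h _ σ
    classical
    let _ := Fintype.ofEquiv β e.symm
    have := h (e.symm.permCongr σ)
    rw [sign_permCongr, cyc_congr (τ := σ) e (by simp)] at this
    convert this using 3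
    exact (Fintype.card_congr e).symm
  · intro _ σ
    rw [cyc_empty, Subsingleton.elim σ 1]; simp
  · intro α _ h dec σ
    classical
    obtain rfl : dec = Option.instDecidableEq := Subsingleton.elim _ _
    obtain ⟨⟨i, τ⟩, rfl⟩ := Perm.decomposeOption.symm.surjective σ
    rw [Perm.decomposeOption_symm_apply]
    rcases i with _ | i
    · rw [swap_self]
      change ((sign τ.optionCongr : ℤˣ) : ℤ) = _
      rw [show (Equiv.refl (Option α) * τ.optionCongr) = τ.optionCongr from rfl,
        cyc_optionCongr, Fintype.card_option, Equiv.optionCongr_sign]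
      rw [show Fintype.card α + 1 + (cyc τ + 1) = Fintype.card α + cyc τ + 2 by ring, pow_add, ← h τ]
      simp
    · rw [cyc_swap_mul_optionCongr, Fintype.card_option, Perm.sign_mul, Equiv.optionCongr_sign,
        sign_swap (by simp)]
      rw [show Fintype.card α + 1 + cyc τ = Fintype.card α + cyc τ + 1 by ring, pow_succ, ← h τ]
      simp

/-- A new element either forms its own cycle, contributing a factor `y`, or is inserted at one of
the existing elements without changing the number of cycles. -/
theorem sum_pow_cyc {R : Type*} [CommRing R] (y : R) (α : Type) [Fintype α] [DecidableEq α] :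
    ∑ σ : Perm α, y ^ cyc σ = ∏ i ∈ Finset.range (Fintype.card α), (y + i) := by
  classical
  revert ‹DecidableEq α›
  refine Fintype.induction_empty_option (P := fun α _ => ∀ [DecidableEq α],
    ∑ σ : Perm α, y ^ cyc σ = ∏ i ∈ Finset.range (Fintype.card α), (y + i)) ?_ ?_ ?_ α
  · intro α β _ e h _
    classical
    let _ := Fintype.ofEquiv β e.symm
    have hc : Fintype.card α = Fintype.card β := Fintype.card_congr e
    rw [← hc, ← h]
    refine (Fintype.sum_equiv e.permCongr _ _ fun σ => ?_).symm
    rw [cyc_congr e]; simp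
  · intro _
    simp [cyc_empty]
  · intro α _ h dec
    classical
    obtain rfl : dec = Option.instDecidableEq := Subsingleton.elim _ _
    rw [← Perm.decomposeOption.symm.sum_comp, Fintype.sum_prod_type, Fintype.sum_option]
    simp only [Perm.decomposeOption_symm_apply, cyc_swap_mul_optionCongr]
    have : ∀ τ : Perm α, cyc (swap none none * τ.optionCongr) = cyc τ + 1 := by
      intro τ
      rw [swap_self]
      exact cyc_optionCongr τ
    simp only [this, pow_succ, ← Finset.sum_mul, Finset.sum_const, Finset.card_univ, h,
      Fintype.card_option, Finset.prod_range_succ, nsmul_eq_mul]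
    ring

theorem sum_sign_mul_pow_cyc {R : Type*} [CommRing R] (y : R) (α : Type) [Fintype α]
    [DecidableEq α] :
    ∑ σ : Perm α, ((sign σ : ℤˣ) : ℤ) * y ^ cyc σ = ∏ i ∈ Finset.range (Fintype.card α), (y - i) := by
  have := congrArg ((-1) ^ Fintype.card α * ·) (sum_pow_cyc (-y) α)
  simp only [Finset.mul_sum] at this
  convert this using 1
  · refine Finset.sum_congr rfl fun σ _ => ?_
    rw [sign_eq_neg_one_pow, neg_pow y, pow_add]; push_cast; ring
  · rw [← Finset.card_range (Fintype.card α), ← Finset.prod_const, Finset.card_range,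
      ← Finset.prod_mul_distrib]
    refine Finset.prod_congr rfl fun i _ => by ring

end PolygonGluing

/-! ### Signed sums over invariant sets. -/

namespace PolygonGluing

open Equiv Equiv.Perm

theorem subtypeCongr_mul {α : Type} [DecidableEq α] (A : Finset α) (σ σ' : Perm {a // a ∈ A})
    (τ τ' : Perm {a // a ∉ A}) :
    Perm.subtypeCongr (σ * σ') (τ * τ') = Perm.subtypeCongr σ τ * Perm.subtypeCongr σ' τ' :=
  map_mul (Perm.subtypeCongrHom (· ∈ A)) (σ, τ) (σ', τ')

theorem subtypeCongr_subtypePerm {α : Type} [DecidableEq α] {A : Finset α} {w : Perm α}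
    (h : ∀ a, w a ∈ A ↔ a ∈ A) (h' : ∀ a, w a ∉ A ↔ a ∉ A) :
    Perm.subtypeCongr (w.subtypePerm h) (w.subtypePerm h') = w := by
  ext a
  by_cases ha : a ∈ A
  · rw [Perm.subtypeCongr.left_apply _ _ ha]; rfl
  · rw [Perm.subtypeCongr.right_apply _ _ ha]; rfl

theorem subtypeCongr_mem_iff {α : Type} [DecidableEq α] {A : Finset α} (σ : Perm {a // a ∈ A})
    (τ : Perm {a // a ∉ A}) (a : α) : Perm.subtypeCongr σ τ a ∈ A ↔ a ∈ A := by
  by_cases ha : a ∈ A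
  · rw [Perm.subtypeCongr.left_apply _ _ ha]; simp [ha]
  · rw [Perm.subtypeCongr.right_apply _ _ ha]; simp [ha, (τ ⟨a, ha⟩).2]

theorem sum_subtypeCongr_eq {α : Type} [Fintype α] [DecidableEq α] {R : Type*} [CommRing R]
    {A : Finset α} {w : Perm α} (h : ∀ a, w a ∈ A ↔ a ∈ A) (f : Perm {a // a ∈ A} → R) :
    ∑ x : Perm {a // a ∈ A} × Perm {a // a ∉ A},
      (if Perm.subtypeCongr x.1 x.2 = w then f x.1 else 0) = f (w.subtypePerm h) := by
  have h' : ∀ a, w a ∉ A ↔ a ∉ A := fun a => not_congr (h a)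
  rw [Finset.sum_eq_single (w.subtypePerm h, w.subtypePerm h')]
  · simp [subtypeCongr_subtypePerm h h']
  · intro x _ hx
    rw [if_neg]
    intro hxw
    refine hx (Perm.subtypeCongrHom_injective (· ∈ A) ?_)
    rw [← subtypeCongr_subtypePerm h h'] at hxw
    exact hxw
  · simp

theorem cyc_subtypePerm {α : Type} {w : Perm α} (T : Finset (Quotient (SameCycle.setoid w)))
    {A : Finset α} (hA : ∀ a, a ∈ A ↔ Quotient.mk (SameCycle.setoid w) a ∈ T)
    (h : ∀ a, w a ∈ A ↔ a ∈ A) : cyc (w.subtypePerm h) = T.card := by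
  have hs : ∀ x y : {a // a ∈ A}, SameCycle (w.subtypePerm h) x y ↔ SameCycle w x y := fun x y =>
    (sameCycle_semiconj_iff (σ := w.subtypePerm h) Subtype.val Subtype.val_injective
      (fun x => rfl)).symm
  rw [← Nat.card_eq_finsetCard T]
  refine Nat.card_congr (Equiv.ofBijective (Quotient.lift (s := SameCycle.setoid (w.subtypePerm h))
    (fun x => (⟨Quotient.mk (SameCycle.setoid w) x, (hA x).1 x.2⟩ : {q // q ∈ T}))
    fun x y hxy => Subtype.ext (Quotient.sound (s := SameCycle.setoid w) ((hs x y).1 hxy))) ⟨?_, ?_⟩)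
  · intro a b hab
    induction a using Quotient.inductionOn with | _ a
    induction b using Quotient.inductionOn with | _ b
    refine Quotient.sound (s := SameCycle.setoid (w.subtypePerm h)) ((hs a b).2 ?_)
    exact Quotient.exact (s := SameCycle.setoid w) (congrArg Subtype.val hab)
  · rintro ⟨q, hq⟩
    induction q using Quotient.inductionOn with | _ a
    exact ⟨Quotient.mk _ ⟨a, (hA a).2 hq⟩, rfl⟩

open Classical in
/-- The signed sum over the invariant sets avoiding a base point detects the permutations with one
cycle only. -/
theorem sum_invariant_sets {α : Type} [Fintype α] [DecidableEq α] {R : Type*} [CommRing R]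
    (w : Perm α) (x₀ : α) :
    ∑ A : Finset α with x₀ ∉ A, ∑ x : Perm {a // a ∈ A} × Perm {a // a ∉ A},
      (if Perm.subtypeCongr x.1 x.2 = w then (-1 : R) ^ cyc x.1 else 0)
      = if ∀ x, SameCycle w x₀ x then 1 else 0 := by
  let q : α → Quotient (SameCycle.setoid w) := Quotient.mk _
  have hq : ∀ a, q (w a) = q a := fun a =>
    Quotient.sound (s := SameCycle.setoid w) (sameCycle_apply_left.2 (SameCycle.refl _ _))
  let Q := Quotient (SameCycle.setoid w)
  have hinv : ∀ (T : Finset Q) (a : α),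
      w a ∈ Finset.univ.filter (fun a => q a ∈ T) ↔ a ∈ Finset.univ.filter (fun a => q a ∈ T) := by
    intro T a; simp [hq]
  -- The invariant sets are the unions of sets of cycles; a set `A` that is not invariant
  -- contributes nothing, as no pair of permutations assembles to `w`.
  have h1 : ∑ T ∈ (Finset.univ.erase (q x₀)).powerset, (-1 : R) ^ T.card
      = ∑ A : Finset α with x₀ ∉ A, ∑ x : Perm {a // a ∈ A} × Perm {a // a ∉ A},
      (if Perm.subtypeCongr x.1 x.2 = w then (-1 : R) ^ cyc x.1 else 0) := by
    refine Finset.sum_of_injOn (fun T => Finset.univ.filter (fun a => q a ∈ T)) ?_ ?_ ?_ ?_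
    · intro T _ T' _ hTT
      ext r
      induction r using Quotient.inductionOn with | _ a
      simpa [q] using Finset.ext_iff.1 hTT a
    · intro T hT
      simp only [Finset.coe_powerset, Set.mem_preimage, Set.mem_powerset_iff, Finset.coe_subset,
        Finset.coe_filter, Finset.mem_univ, true_and, Set.mem_ofPred_eq, Finset.mem_filter] at hT ⊢
      exact fun h => (Finset.mem_erase.1 (hT h)).1 rfl
    · intro A hA hA'
      refine Finset.sum_eq_zero fun x _ => if_neg fun hx => hA' ?_
      have hAw : ∀ a, w a ∈ A ↔ a ∈ A := fun a => by rw [← hx]; exact subtypeCongr_mem_iff _ _ a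
      have hAq : ∀ a b, q a = q b → (a ∈ A ↔ b ∈ A) := fun a b hab => by
        have := SameCycle.map_eq (f := fun a => a ∈ A) (fun a => propext (hAw a))
          (Quotient.exact (s := SameCycle.setoid w) hab)
        exact iff_of_eq this
      refine ⟨A.image q, ?_, ?_⟩
      · simp only [Finset.mem_coe, Finset.mem_powerset]
        intro r hr
        obtain ⟨a, ha, rfl⟩ := Finset.mem_image.1 hr
        refine Finset.mem_erase.2 ⟨fun hh => ?_, Finset.mem_univ _⟩
        exact (Finset.mem_filter.1 hA).2 ((hAq _ _ hh).1 ha)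
      · ext a
        simp only [Finset.mem_filter, Finset.mem_univ, true_and, Finset.mem_image]
        exact ⟨fun ⟨b, hb, hba⟩ => (hAq _ _ hba).1 hb, fun ha => ⟨a, ha, rfl⟩⟩
    · intro T _
      rw [sum_subtypeCongr_eq (hinv T) (fun σ => (-1 : R) ^ cyc σ),
        cyc_subtypePerm T (by simp [q]) (hinv T)]
  rw [← h1]
  have h2 := congrArg (Int.cast : ℤ → R) (Finset.sum_powerset_neg_one_pow_card
    (x := (Finset.univ.erase (q x₀))))
  push_cast at h2
  rw [h2]
  refine if_congr ?_ rfl rfl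
  rw [Finset.eq_empty_iff_forall_notMem]
  constructor
  · intro h x
    by_contra hx
    exact h (q x) (Finset.mem_erase.2
      ⟨fun hh => hx (Quotient.exact (s := SameCycle.setoid w) hh.symm), Finset.mem_univ _⟩)
  · intro h r hr
    induction r using Quotient.inductionOn with | _ x
    exact (Finset.mem_erase.1 hr).1 (Quotient.sound (s := SameCycle.setoid w) (h x).symm)

/-- The contribution of the set `A` to the sum over the permutations `w` with one cycle of
`y ^ cyc (w * p)`. -/
noncomputable def weight {α : Type} [Fintype α] [DecidableEq α] {R : Type*} [CommRing R] (y : R)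
    (p : Perm α) (A : Finset α) : R :=
  ∑ x : Perm {a // a ∈ A} × Perm {a // a ∉ A},
    (-1) ^ cyc x.1 * y ^ cyc (Perm.subtypeCongr x.1 x.2 * p)

open Classical in
theorem sum_long_eq_sum_weight {α : Type} [Fintype α] [DecidableEq α] {R : Type*} [CommRing R]
    (y : R) (p : Perm α) (x₀ : α) :
    ∑ w : Perm α with ∀ x, SameCycle w x₀ x, y ^ cyc (w * p)
      = ∑ A : Finset α with x₀ ∉ A, weight y p A := by
  have : ∀ w : Perm α, (if ∀ x, SameCycle w x₀ x then y ^ cyc (w * p) else 0) =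
      ∑ A : Finset α with x₀ ∉ A, ∑ x : Perm {a // a ∈ A} × Perm {a // a ∉ A},
      (if Perm.subtypeCongr x.1 x.2 = w then (-1 : R) ^ cyc x.1 * y ^ cyc (w * p) else 0) := by
    intro w
    have := congrArg (· * y ^ cyc (w * p)) (sum_invariant_sets (R := R) w x₀)
    simp only [Finset.sum_mul, ite_mul, zero_mul, one_mul] at this
    rw [this]
  rw [Finset.sum_filter, Finset.sum_congr rfl fun w _ => this w, Finset.sum_comm]
  refine Finset.sum_congr rfl fun A _ => ?_
  rw [Finset.sum_comm]
  refine Finset.sum_congr rfl fun x _ => ?_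
  rw [Finset.sum_ite_eq]; simp

theorem neg_one_pow_cyc {α : Type} [Fintype α] [DecidableEq α] {R : Type*} [CommRing R]
    (σ : Perm α) : (-1 : R) ^ cyc σ = (-1) ^ Fintype.card α * ((sign σ : ℤˣ) : ℤ) := by
  rw [sign_eq_neg_one_pow]
  push_cast
  rw [pow_add, ← mul_assoc, ← mul_pow]
  simp

/-- Multiplying the first permutation by `swap a b` on the left and the second by `swap (p a) (p b)`
on the right conjugates the product with `p` by `swap a b`. This keeps its number of cycles and
reverses the sign, so the terms cancel in pairs. -/
theorem weight_eq_zero {α : Type} [Fintype α] [DecidableEq α] {R : Type*} [CommRing R] (y : R)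
    {p : Perm α} {A : Finset α} {a b : α} (hab : a ≠ b) (ha : a ∈ A)
    (hb : b ∈ A) (hpa : p a ∉ A) (hpb : p b ∉ A) : weight y p A = 0 := by
  have hab' : (⟨a, ha⟩ : {a // a ∈ A}) ≠ ⟨b, hb⟩ := by simpa using hab
  refine Finset.sum_involution (fun x _ => (swap ⟨a, ha⟩ ⟨b, hb⟩ * x.1,
    x.2 * swap ⟨p a, hpa⟩ ⟨p b, hpb⟩)) ?_ ?_ ?_ ?_
  · rintro ⟨σ, τ⟩ _
    have h1 : Perm.subtypeCongr (swap ⟨a, ha⟩ ⟨b, hb⟩ : Perm {a // a ∈ A}) 1 = swap a b := by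
      ext x
      by_cases hx : x ∈ A
      · rw [Perm.subtypeCongr.left_apply _ _ hx, swap_apply_def, swap_apply_def]
        simp only [Subtype.mk.injEq]; split_ifs <;> rfl
      · rw [Perm.subtypeCongr.right_apply _ _ hx, swap_apply_of_ne_of_ne]
        · rfl
        · rintro rfl; exact hx ha
        · rintro rfl; exact hx hb
    have h2 : Perm.subtypeCongr (1 : Perm {a // a ∈ A}) (swap ⟨p a, hpa⟩ ⟨p b, hpb⟩)
        = swap (p a) (p b) := by
      ext x
      by_cases hx : x ∈ A
      · rw [Perm.subtypeCongr.left_apply _ _ hx, swap_apply_of_ne_of_ne]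
        · rfl
        · rintro rfl; exact hpa hx
        · rintro rfl; exact hpb hx
      · rw [Perm.subtypeCongr.right_apply _ _ hx, swap_apply_def, swap_apply_def]
        simp only [Subtype.mk.injEq]; split_ifs <;> rfl
    have h3 : Perm.subtypeCongr (swap ⟨a, ha⟩ ⟨b, hb⟩ * σ) (τ * swap ⟨p a, hpa⟩ ⟨p b, hpb⟩) * p
        = swap a b * (Perm.subtypeCongr σ τ * p) * (swap a b)⁻¹ := by
      rw [← h1, show Perm.subtypeCongr (swap ⟨a, ha⟩ ⟨b, hb⟩ * σ)
        (τ * swap ⟨p a, hpa⟩ ⟨p b, hpb⟩) = Perm.subtypeCongr (swap ⟨a, ha⟩ ⟨b, hb⟩ * σ * 1)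
        (1 * τ * swap ⟨p a, hpa⟩ ⟨p b, hpb⟩) by simp, subtypeCongr_mul, subtypeCongr_mul, h1, h2,
        swap_inv, mul_assoc, ← mul_swap_eq_swap_mul]
      simp only [mul_assoc]
    simp only [h3, cyc_conj, neg_one_pow_cyc, Perm.sign_mul, sign_swap hab']
    push_cast
    ring
  · rintro ⟨σ, τ⟩ _ _ h
    simp only [Prod.mk.injEq, mul_eq_right, swap_eq_one_iff] at h
    exact hab' h.1
  · simp
  · rintro ⟨σ, τ⟩ _
    simp [← mul_assoc]

/-- As `q` acts inside `A` and `r` inside its complement, both are absorbed by translating the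
summation variables, at the price of the sign of `q`. What remains is a product of two independent
cycle sums. -/
theorem weight_mul {α : Type} [Fintype α] [DecidableEq α] {R : Type*} [CommRing R] (y : R)
    {A : Finset α} {q r : Perm α} (hq : ∀ a ∉ A, q a = a) (hr : ∀ a ∈ A, r a = a) :
    weight y (q * r) A = (-1) ^ A.card * ((sign q : ℤˣ) : ℤ)
      * ((∏ i ∈ Finset.range A.card, (y - i)) * ∏ i ∈ Finset.range Aᶜ.card, (y + i)) := by
  have hqA : ∀ a, q a ∈ A ↔ a ∈ A := fun a => by
    by_cases ha : a ∈ A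
    · simp only [ha, iff_true]
      by_contra h
      have := q.injective (hq _ h)
      rw [this] at h; exact h ha
    · rw [hq a ha]
  have hrA : ∀ a, r a ∉ A ↔ a ∉ A := fun a => by
    by_cases ha : a ∈ A
    · rw [hr a ha]
    · simp only [ha, not_false_iff, iff_true]
      intro h
      have := r.injective (hr _ h)
      rw [this] at h; exact ha h
  set q' := q.subtypePerm hqA
  set r' : Perm {a // a ∉ A} := r.subtypePerm hrA
  have h1 : Perm.subtypeCongr q' 1 = q := by
    ext a
    by_cases ha : a ∈ A
    · rw [Perm.subtypeCongr.left_apply _ _ ha]; rfl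
    · rw [Perm.subtypeCongr.right_apply _ _ ha, hq a ha]; rfl
  have h2 : Perm.subtypeCongr 1 r' = r := by
    ext a
    by_cases ha : a ∈ A
    · rw [Perm.subtypeCongr.left_apply _ _ ha, hr a ha]; rfl
    · rw [Perm.subtypeCongr.right_apply _ _ ha]; rfl
  have h3 : q * r = Perm.subtypeCongr q' r' := by
    rw [← h1, ← h2, ← subtypeCongr_mul]; simp
  have h4 : sign q = sign q' := by
    rw [← h1, sign_subtypeCongr, Perm.sign_one, mul_one]; congr!
  have hcA : Fintype.card {a // a ∈ A} = A.card := Fintype.card_coe A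
  have hcA' : Fintype.card {a // a ∉ A} = Aᶜ.card := by
    rw [Fintype.card_subtype]; congr 1; ext; simp
  rw [weight, h3, h4, ← hcA, ← hcA', ← sum_sign_mul_pow_cyc, ← sum_pow_cyc, Finset.sum_mul_sum,
    ← Finset.univ_product_univ, Finset.sum_product, Finset.mul_sum,
    ← Equiv.sum_comp (Equiv.mulRight q'⁻¹)]
  refine Finset.sum_congr rfl fun σ _ => ?_
  rw [Finset.mul_sum, ← Equiv.sum_comp (Equiv.mulRight r'⁻¹)]
  refine Finset.sum_congr rfl fun τ _ => ?_
  simp only [Equiv.coe_mulRight]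
  rw [← subtypeCongr_mul, cyc_subtypeCongr, neg_one_pow_cyc, Perm.sign_mul, sign_inv]
  simp only [inv_mul_cancel_right]
  push_cast
  ring

/-- The product without the transposition preserves `A`, so `a` and `b` lie in different cycles,
which the transposition merges: every term loses one factor `y`. -/
theorem weight_mul_swap {α : Type} [Fintype α] [DecidableEq α] {R : Type*} [CommRing R] (y : R)
    {A : Finset α} {p : Perm α} (hp : ∀ x, p x ∈ A ↔ x ∈ A) {a b : α} (ha : a ∈ A)
    (hb : b ∉ A) : y * weight y (p * swap a b) A = weight y p A := by
  rw [weight, weight, Finset.mul_sum]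
  refine Finset.sum_congr rfl fun x _ => ?_
  have : ¬ SameCycle (Perm.subtypeCongr x.1 x.2 * p) a b := by
    intro h
    have := SameCycle.map_eq (f := fun a => a ∈ A)
      (fun a => propext ((subtypeCongr_mem_iff x.1 x.2 (p a)).trans (hp a))) h
    simp [ha, hb] at this
  rw [← cyc_mul_swap this, mul_assoc, pow_succ]
  ring

end PolygonGluing

/-! ### The model pairing with one fixed point. -/

namespace PolygonGluing

open Equiv Equiv.Perm

/-- The involution of `Option (ι × Bool)` that exchanges `(i, false)` and `(i, true)` for
`i ∈ S` and fixes everything else. -/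
def flipOn {ι : Type} [DecidableEq ι] (S : Finset ι) : Perm (Option (ι × Bool)) :=
  Function.Involutive.toPerm
    (Option.map fun x => (x.1, if x.1 ∈ S then !x.2 else x.2)) (by
      rintro (_ | ⟨i, b⟩)
      · rfl
      · by_cases h : i ∈ S <;> simp [h])

theorem flipOn_none {ι : Type} [DecidableEq ι] (S : Finset ι) : flipOn S none = none := rfl

theorem flipOn_some {ι : Type} [DecidableEq ι] (S : Finset ι) (i : ι) (b : Bool) :
    flipOn S (some (i, b)) = some (i, if i ∈ S then !b else b) := rfl

theorem flipOn_univ_some {ι : Type} [DecidableEq ι] [Fintype ι] (x : ι × Bool) :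
    flipOn Finset.univ (some x) = some (x.1, !x.2) := by
  obtain ⟨i, b⟩ := x
  simp [flipOn_some]

theorem flipOn_union {ι : Type} [DecidableEq ι] {S T : Finset ι} (h : Disjoint S T) :
    flipOn (S ∪ T) = flipOn S * flipOn T := by
  ext1 x
  rcases x with _ | ⟨i, b⟩
  · rfl
  · rw [Perm.mul_apply, flipOn_some, flipOn_some, flipOn_some]
    by_cases hS : i ∈ S
    · simp [hS, Finset.disjoint_left.1 h hS]
    · simp [hS]

theorem flipOn_singleton {ι : Type} [DecidableEq ι] (i : ι) (b : Bool) :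
    flipOn {i} = swap (some (i, b)) (some (i, !b)) := by
  ext1 x
  rcases x with _ | ⟨j, c⟩
  · rw [swap_apply_of_ne_of_ne (by simp) (by simp)]; rfl
  · rw [flipOn_some, swap_apply_def]
    by_cases hij : j = i
    · subst hij; cases b <;> cases c <;> simp
    · simp [hij]

theorem sign_flipOn {ι : Type} [DecidableEq ι] [Fintype ι] (S : Finset ι) :
    sign (flipOn S) = (-1) ^ S.card := by
  induction S using Finset.induction_on with
  | empty =>
    rw [show flipOn (∅ : Finset ι) = 1 from ?_]
    · simp
    · ext1 x
      rcases x with _ | ⟨j, c⟩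
      · rfl
      · simp [flipOn_some]
  | insert i S hi ih =>
    rw [Finset.insert_eq, flipOn_union (by simpa using hi), Perm.sign_mul, ih,
      flipOn_singleton i true, sign_swap (by simp), Finset.card_union_of_disjoint (by simpa using hi)]
    simp [pow_add]

/-- The set of all `(i, b)` with `i ∈ S`, together with one further element if `o ≠ none`. -/
def blockSet {ι : Type} [DecidableEq ι] (S : Finset ι) (o : Option (ι × Bool)) :
    Finset (Option (ι × Bool)) :=
  (S ×ˢ Finset.univ ∪ o.toFinset).map Function.Embedding.some

theorem none_notMem_blockSet {ι : Type} [DecidableEq ι] (S : Finset ι) (o : Option (ι × Bool)) :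
    none ∉ blockSet S o := by simp [blockSet]

theorem some_mem_blockSet {ι : Type} [DecidableEq ι] {S : Finset ι} {o : Option (ι × Bool)}
    {x : ι × Bool} : some x ∈ blockSet S o ↔ x.1 ∈ S ∨ o = some x := by
  simp [blockSet]

theorem card_blockSet_none {ι : Type} [DecidableEq ι] (S : Finset ι) :
    (blockSet S none).card = 2 * S.card := by
  simp [blockSet, mul_comm]

theorem card_blockSet_some {ι : Type} [DecidableEq ι] {S : Finset ι} {x : ι × Bool} (h : x.1 ∉ S) :
    (blockSet S (some x)).card = 2 * S.card + 1 := by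
  rw [blockSet, Finset.card_map, Finset.card_union_of_disjoint]
  · simp [mul_comm]
  · simp [h]

theorem card_option_prod_bool {ι : Type} [Fintype ι] :
    Fintype.card (Option (ι × Bool)) = 2 * Fintype.card ι + 1 := by
  simp [mul_comm]

theorem weight_blockSet_none {ι : Type} [DecidableEq ι] [Fintype ι] {R : Type*} [CommRing R]
    (y : R) (S : Finset ι) :
    weight y (flipOn Finset.univ) (blockSet S none) = (-1) ^ S.card *
      ((∏ i ∈ Finset.range (2 * S.card), (y - i))
        * ∏ i ∈ Finset.range (2 * Fintype.card ι + 1 - 2 * S.card), (y + i)) := by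
  rw [← Finset.union_compl S, flipOn_union disjoint_compl_right, weight_mul, sign_flipOn,
    Finset.card_compl, card_blockSet_none, card_option_prod_bool]
  · push_cast
    rw [pow_mul]; simp
  · rintro (_ | ⟨i, b⟩) h
    · rfl
    · rw [some_mem_blockSet] at h
      simp only [not_or] at h
      simp [flipOn_some, h.1]
  · rintro (_ | ⟨i, b⟩) h
    · rfl
    · rw [some_mem_blockSet] at h
      simp only [reduceCtorEq, or_false] at h
      simp [flipOn_some, h]

/-- The set cuts the pair of `x` only. Splitting off the transposition of this pair costs a factor
`y`, and the rest of the involution preserves the set. The odd size of the set accounts for the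
additional sign. -/
theorem weight_blockSet_some {ι : Type} [DecidableEq ι] [Fintype ι] {R : Type*} [CommRing R]
    (y : R) (S : Finset ι) (x : ι × Bool) (hx : x.1 ∉ S) :
    y * weight y (flipOn Finset.univ) (blockSet S (some x)) = - (-1) ^ S.card *
      ((∏ i ∈ Finset.range (2 * S.card + 1), (y - i))
        * ∏ i ∈ Finset.range (2 * Fintype.card ι - 2 * S.card), (y + i)) := by
  obtain ⟨i, b⟩ := x
  have hu : (Finset.univ : Finset ι) = S ∪ (S ∪ {i})ᶜ ∪ {i} := by
    ext j; by_cases hj : j ∈ S <;> by_cases hi : j = i <;> simp [hj, hi]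
  have hd1 : Disjoint S (S ∪ {i})ᶜ := by
    rw [Finset.disjoint_left]; intro j hj; simp [hj]
  have hd2 : Disjoint (S ∪ (S ∪ {i})ᶜ) {i} := by simpa using hx
  rw [hu, flipOn_union hd2, flipOn_union hd1, flipOn_singleton i b, weight_mul_swap, weight_mul,
    sign_flipOn, Finset.card_compl, card_blockSet_some hx, card_option_prod_bool, Nat.add_sub_add_right]
  · push_cast
    rw [pow_succ, pow_mul]; simp
  · rintro (_ | ⟨j, c⟩) h
    · rfl
    · rw [some_mem_blockSet] at h
      simp only [not_or] at h
      simp [flipOn_some, h.1]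
  · rintro (_ | ⟨j, c⟩) h
    · rfl
    · rw [some_mem_blockSet] at h
      rw [flipOn_some, if_neg]
      simp only [Finset.mem_compl, Finset.mem_union, Finset.mem_singleton, not_not]
      rcases h with h | h
      · exact Or.inl h
      · simp only [Option.some.injEq, Prod.mk.injEq] at h
        exact Or.inr h.1.symm
  · rintro (_ | ⟨j, c⟩)
    · simp [flipOn_none]
    · rw [← flipOn_union hd1, flipOn_some, some_mem_blockSet, some_mem_blockSet]
      by_cases hj : j = i
      · subst hj; simp [hx]
      · simp [Ne.symm hj]
  · simp [some_mem_blockSet]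
  · simp [some_mem_blockSet, hx]

/-- A set avoiding `none` that cuts at most one pair is a block set; any other one cuts two pairs,
so `weight_eq_zero` applies. -/
theorem weight_eq_zero_of_ne_blockSet {ι : Type} [DecidableEq ι] [Fintype ι] {R : Type*}
    [CommRing R] (y : R) {A : Finset (Option (ι × Bool))} (hA : none ∉ A)
    (h : ∀ S o, (∀ x, o = some x → x.1 ∉ S) → blockSet S o ≠ A) :
    weight y (flipOn Finset.univ) A = 0 := by
  let S : Finset ι := Finset.univ.filter fun i => ∀ b, some (i, b) ∈ A
  by_cases hne : ∃ x : ι × Bool, some x ∈ A ∧ some (x.1, !x.2) ∉ A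
  · obtain ⟨x, hx, hx'⟩ := hne
    have hxS : x.1 ∉ S := by
      simp only [S, Finset.mem_filter, Finset.mem_univ, true_and]; exact fun h => hx' (h _)
    have := h S (some x) (by rintro _ ⟨⟩; exact hxS)
    by_cases h2 : ∃ z : ι × Bool, z ≠ x ∧ some z ∈ A ∧ some (z.1, !z.2) ∉ A
    · obtain ⟨z, hz, hzA, hzA'⟩ := h2
      refine weight_eq_zero y (a := some x) (b := some z) (by simpa using Ne.symm hz) hx hzA ?_ ?_
      · rwa [flipOn_univ_some]
      · rwa [flipOn_univ_some]
    · exfalso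
      refine this ?_
      ext (_ | z)
      · simp [none_notMem_blockSet, hA]
      · rw [some_mem_blockSet]
        simp only [S, Finset.mem_filter, Finset.mem_univ, true_and, Option.some.injEq]
        constructor
        · rintro (h | rfl)
          · exact h z.2
          · exact hx
        · intro hz
          by_cases hzx : x = z
          · exact Or.inr hzx
          · left
            have : some (z.1, !z.2) ∈ A := by
              by_contra hz'; exact h2 ⟨z, Ne.symm hzx, hz, hz'⟩
            obtain ⟨j, c⟩ := z
            rintro b
            by_cases hb : b = c
            · rw [hb]; exact hz
            · rw [show b = !c by cases b <;> cases c <;> simp_all]; exact this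
  · exfalso
    refine h S none (by simp) ?_
    ext (_ | z)
    · simp [none_notMem_blockSet, hA]
    · rw [some_mem_blockSet]
      simp only [S, Finset.mem_filter, Finset.mem_univ, true_and, reduceCtorEq, or_false]
      constructor
      · exact fun h => h z.2
      · intro hz
        have : some (z.1, !z.2) ∈ A := by
          by_contra hz'; exact hne ⟨z, hz, hz'⟩
        obtain ⟨j, c⟩ := z
        rintro b
        by_cases hb : b = c
        · rw [hb]; exact hz
        · rw [show b = !c by cases b <;> cases c <;> simp_all]; exact this

theorem sum_weight {ι : Type} [DecidableEq ι] [Fintype ι] {R : Type*} [CommRing R] (y : R) :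
    ∑ A : Finset (Option (ι × Bool)) with none ∉ A, weight y (flipOn Finset.univ) A
      = ∑ S : Finset ι, (weight y (flipOn Finset.univ) (blockSet S none)
        + ∑ x : ι × Bool with x.1 ∉ S, weight y (flipOn Finset.univ) (blockSet S (some x))) := by
  have h1 : ∑ z : Finset ι × Option (ι × Bool) with (∀ x, z.2 = some x → x.1 ∉ z.1),
      weight y (flipOn Finset.univ) (blockSet z.1 z.2)
      = ∑ A : Finset (Option (ι × Bool)) with none ∉ A, weight y (flipOn Finset.univ) A := by
    refine Finset.sum_of_injOn (fun z => blockSet z.1 z.2) ?_ ?_ ?_ ?_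
    · rintro ⟨S, o⟩ h ⟨S', o'⟩ h' hh
      simp only [Finset.coe_filter, Finset.mem_univ, true_and, Set.mem_ofPred_eq] at h h' hh
      have key : ∀ x : ι × Bool, (x.1 ∈ S ∨ o = some x) ↔ (x.1 ∈ S' ∨ o' = some x) := fun x => by
        rw [← some_mem_blockSet, hh, some_mem_blockSet]
      -- Membership of both elements of a pair cannot come from the single further element, so the
      -- set determines `S`, and then the further element.
      have hS : ∀ {S S' : Finset ι} {o o' : Option (ι × Bool)}, (∀ x, o' = some x → x.1 ∉ S') →
          (∀ x : ι × Bool, (x.1 ∈ S ∨ o = some x) ↔ (x.1 ∈ S' ∨ o' = some x)) →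
          ∀ i ∈ S, i ∈ S' := by
        intro S S' o o' h' key i hi
        by_contra hi'
        have h1 := ((key (i, true)).1 (Or.inl hi)).resolve_left hi'
        have h2 := ((key (i, false)).1 (Or.inl hi)).resolve_left hi'
        rw [h1] at h2; simp at h2
      have hSS : S = S' := Finset.Subset.antisymm (hS h' key) (hS h fun x => (key x).symm)
      subst hSS
      simp only [Prod.mk.injEq, true_and]
      ext x
      constructor
      · exact fun hx => ((key x).1 (Or.inr hx)).resolve_left (h x hx)
      · exact fun hx => ((key x).2 (Or.inr hx)).resolve_left (h' x hx)
    · intro z _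
      simp [none_notMem_blockSet]
    · intro A hA hA'
      refine weight_eq_zero_of_ne_blockSet y (by simpa using hA) fun S o hSo hA'' => hA' ?_
      exact ⟨(S, o), by simpa using hSo, hA''⟩
    · intro z _; rfl
  rw [← h1, Finset.sum_filter, Fintype.sum_prod_type]
  refine Finset.sum_congr rfl fun S _ => ?_
  rw [Fintype.sum_option, Finset.sum_filter]
  simp

open Classical in
/-- The sum over all permutations `w` with a single cycle of `y ^ cyc (w * p)`, for an involution
`p` with a single fixed point. -/
theorem sum_long_flipOn {ι : Type} [DecidableEq ι] [Fintype ι] {R : Type*} [CommRing R] (y : R) :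
    y * ∑ w : Perm (Option (ι × Bool)) with ∀ x, SameCycle w none x,
        y ^ cyc (w * flipOn Finset.univ)
      = ∑ s ∈ Finset.range (Fintype.card ι + 1), (Fintype.card ι).choose s * (-1) ^ s *
        (y * ((∏ i ∈ Finset.range (2 * s), (y - i))
          * ∏ i ∈ Finset.range (2 * Fintype.card ι + 1 - 2 * s), (y + i))
        - (2 * (Fintype.card ι - s) : ℕ) * ((∏ i ∈ Finset.range (2 * s + 1), (y - i))
          * ∏ i ∈ Finset.range (2 * Fintype.card ι - 2 * s), (y + i))) := by
  rw [sum_long_eq_sum_weight, sum_weight, Finset.mul_sum]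
  let F : ℕ → R := fun s => (-1) ^ s *
        (y * ((∏ i ∈ Finset.range (2 * s), (y - i))
          * ∏ i ∈ Finset.range (2 * Fintype.card ι + 1 - 2 * s), (y + i))
        - (2 * (Fintype.card ι - s) : ℕ) * ((∏ i ∈ Finset.range (2 * s + 1), (y - i))
          * ∏ i ∈ Finset.range (2 * Fintype.card ι - 2 * s), (y + i)))
  have h : ∀ S : Finset ι, y * (weight y (flipOn Finset.univ) (blockSet S none)
        + ∑ x : ι × Bool with x.1 ∉ S, weight y (flipOn Finset.univ) (blockSet S (some x)))
      = F S.card := by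
    intro S
    rw [mul_add, Finset.mul_sum, weight_blockSet_none, Finset.sum_congr rfl fun x hx =>
      weight_blockSet_some y S x (by simpa using hx), Finset.sum_const]
    have : (Finset.univ.filter fun x : ι × Bool => x.1 ∉ S).card = 2 * (Fintype.card ι - S.card) := by
      rw [show (Finset.univ.filter fun x : ι × Bool => x.1 ∉ S) = Sᶜ ×ˢ Finset.univ by
        ext x; simp, Finset.card_product, Finset.card_compl]
      simp [mul_comm]
    rw [this, nsmul_eq_mul]
    simp only [F]
    ring
  rw [Finset.sum_congr rfl fun S _ => h S, ← Finset.powerset_univ]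
  rw [Finset.sum_powerset_apply_card F, Finset.card_univ]
  refine Finset.sum_congr rfl fun s _ => ?_
  rw [nsmul_eq_mul, mul_assoc]

end PolygonGluing

/-! ### The alternating sum as a power series coefficient. -/

namespace PolygonGluing

open PowerSeries

/-- Shifting `s` in the first summand and using `(s + 1) * choose N (s + 1) = (N - s) * choose N s`
makes the two halves cancel. -/
theorem sum_choose_telescope (N : ℕ) (W : ℕ → ℚ) :
    ∑ s ∈ Finset.range (N + 1), (N.choose s : ℚ) * (-1) ^ s * (s * W s + (N - s : ℕ) * W (s + 1))
      = 0 := by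
  have h1 : ∑ s ∈ Finset.range (N + 1), (N.choose s : ℚ) * (-1) ^ s * (s * W s)
      = ∑ s ∈ Finset.range N, (N.choose (s + 1) : ℚ) * (-1) ^ (s + 1) * ((s + 1 : ℕ) * W (s + 1)) := by
    rw [Finset.sum_range_succ']; simp
  have h2 : ∑ s ∈ Finset.range (N + 1), (N.choose s : ℚ) * (-1) ^ s * ((N - s : ℕ) * W (s + 1))
      = ∑ s ∈ Finset.range N, (N.choose s : ℚ) * (-1) ^ s * ((N - s : ℕ) * W (s + 1)) := by
    rw [Finset.sum_range_succ]; simp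
  simp only [mul_add, Finset.sum_add_distrib] at *
  rw [h1, h2, ← Finset.sum_add_distrib]
  refine Finset.sum_eq_zero fun s _ => ?_
  have := congrArg (Nat.cast (R := ℚ)) (Nat.choose_succ_right_eq N s)
  push_cast at this ⊢
  rw [pow_succ]
  linear_combination (-(-1) ^ s * W (s + 1)) * this

/-- Passing from `k` to `k + 1` multiplies both sides by `(y - k) / (y + n - k)`; positivity of `y`
makes the denominator nonzero. -/
theorem prod_range_sub_mul_prod_range_add (y : ℚ) (hy : 0 < y) (n k : ℕ) (hk : k ≤ n + 1) :
    (∏ i ∈ Finset.range k, (y - i)) * ∏ i ∈ Finset.range (n + 1 - k), (y + i)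
      = y * ∏ i ∈ Finset.range n, (y - k + 1 + i) := by
  induction k with
  | zero =>
    rw [Nat.sub_zero, Finset.prod_range_succ']
    simp only [Finset.range_zero, Finset.prod_empty, one_mul, Nat.cast_zero, add_zero, sub_zero]
    rw [mul_comm]
    congr 1
    exact Finset.prod_congr rfl fun i _ => by push_cast; ring
  | succ k ih =>
    have ih := ih (by omega)
    have hpos : (y + (n - k : ℕ)) ≠ 0 := by positivity
    have e1 : ∏ i ∈ Finset.range (n + 1 - k), (y + i)
        = (∏ i ∈ Finset.range (n + 1 - (k + 1)), (y + i)) * (y + (n - k : ℕ)) := by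
      rw [show n + 1 - k = (n - k) + 1 by omega, Finset.prod_range_succ,
        show n + 1 - (k + 1) = n - k by omega]
    have e2 : (∏ i ∈ Finset.range n, (y - k + 1 + i)) * (y - k)
        = (∏ i ∈ Finset.range n, (y - (k + 1 : ℕ) + 1 + i)) * (y + (n - k : ℕ)) := by
      have a := Finset.prod_range_succ' (fun i : ℕ => y - k + i) n
      have b := Finset.prod_range_succ (fun i : ℕ => y - k + i) n
      rw [a] at b
      rw [Nat.cast_sub (by omega : k ≤ n)]
      convert b using 1
      · simp only [Nat.cast_zero, add_zero]
        congr 1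
        exact Finset.prod_congr rfl fun i _ => by push_cast; ring
      · congr 1
        · exact Finset.prod_congr rfl fun i _ => by push_cast; ring
        · ring
    rw [e1] at ih
    refine mul_right_cancel₀ hpos ?_
    rw [Finset.prod_range_succ]
    linear_combination (y - k) * ih + y * e2

/-- The alternating sum of products that counts permutations simplifies. -/
theorem sum_choose_mul_prod (N : ℕ) (y : ℚ) (hy : 0 < y) :
    (2 * N + 1) * ∑ s ∈ Finset.range (N + 1), (N.choose s : ℚ) * (-1) ^ s *
        (y * ((∏ i ∈ Finset.range (2 * s), (y - i))
          * ∏ i ∈ Finset.range (2 * N + 1 - 2 * s), (y + i))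
        - (2 * (N - s) : ℕ) * ((∏ i ∈ Finset.range (2 * s + 1), (y - i))
          * ∏ i ∈ Finset.range (2 * N - 2 * s), (y + i)))
      = y * ∑ s ∈ Finset.range (N + 1), (N.choose s : ℚ) * (-1) ^ s *
        ∏ i ∈ Finset.range (2 * N + 1), (y - (2 * s : ℕ) + i) := by
  let V : ℕ → ℚ := fun k => ∏ i ∈ Finset.range (2 * N + 1), (y - k + 1 + i)
  let E : ℕ → ℚ := fun k => ∏ i ∈ Finset.range (2 * N), (y - k + 1 + i)
  have hV1 : ∀ k, V k = E k * (y - k + 1 + 2 * N) := fun k => by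
    simp only [V, E]; rw [Finset.prod_range_succ]; push_cast; ring
  have hV2 : ∀ k, V (k + 1) = E k * (y - k) := fun k => by
    simp only [V, E]; rw [Finset.prod_range_succ']
    congr 1
    · exact Finset.prod_congr rfl fun i _ => by push_cast; ring
    · push_cast; ring
  -- Since `(2N + 1) * E k = V k - V (k + 1)`, the terms with `V (2s + 1)` drop out of the
  -- difference of the two sides, leaving `s * W s + (N - s) * W (s + 1)` for this `W`.
  have hz := sum_choose_telescope N (fun s => 2 * y * V (2 * s))
  rw [Finset.mul_sum, Finset.mul_sum, ← sub_eq_zero, ← Finset.sum_sub_distrib, ← hz]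
  refine Finset.sum_congr rfl fun s hs => ?_
  have hs : s ≤ N := by simpa [Nat.lt_succ_iff] using hs
  have hU1 := prod_range_sub_mul_prod_range_add y hy (2 * N) (2 * s) (by omega)
  have hU2 := prod_range_sub_mul_prod_range_add y hy (2 * N) (2 * s + 1) (by omega)
  rw [show 2 * N + 1 - (2 * s + 1) = 2 * N - 2 * s by omega] at hU2
  have hV : ∏ i ∈ Finset.range (2 * N + 1), (y - (2 * s : ℕ) + i) = V (2 * s + 1) :=
    Finset.prod_congr rfl fun i _ => by push_cast; ring
  rw [hU1, hU2, hV]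
  change _ * (_ * (y * (y * E (2 * s)) - _ * (y * E (2 * s + 1)))) - _ = _
  have a1 := hV1 (2 * s)
  have a2 := hV2 (2 * s)
  have a3 := hV1 (2 * s + 1)
  have a4 := hV2 (2 * s + 1)
  rw [show 2 * (s + 1) = 2 * s + 1 + 1 by ring]
  push_cast [Nat.cast_sub hs] at *
  have b1 : (2 * N + 1) * E (2 * s) = V (2 * s) - V (2 * s + 1) := by rw [a1, a2]; ring
  have b2 : (2 * N + 1) * E (2 * s + 1) = V (2 * s + 1) - V (2 * s + 1 + 1) := by rw [a3, a4]; ring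
  linear_combination (N.choose s : ℚ) * (-1) ^ s * y * (2 * s * b1 - (2 * N + 1) * a2 - 2 * (N - s) * b2)

/-- The geometric series. -/
noncomputable def geom : ℚ⟦X⟧ := PowerSeries.mk 1

theorem geom_mul : geom * (1 - X) = 1 := mk_one_mul_one_sub_eq_one ℚ

theorem coeff_one_sub_X_pow_eq_zero {d n : ℕ} (h : d < n) : coeff n ((1 - X : ℚ⟦X⟧) ^ d) = 0 := by
  have : ((1 - X : ℚ⟦X⟧) ^ d) = (((1 - Polynomial.X) ^ d : Polynomial ℚ) : ℚ⟦X⟧) := by simp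
  rw [this, Polynomial.coeff_coe]
  refine Polynomial.coeff_eq_zero_of_natDegree_lt (lt_of_le_of_lt ?_ h)
  refine (Polynomial.natDegree_pow_le).trans ?_
  have : (1 - Polynomial.X : Polynomial ℚ).natDegree ≤ 1 := by
    rw [show (1 - Polynomial.X : Polynomial ℚ) = Polynomial.C 1 - Polynomial.X by simp]
    compute_degree
  nlinarith

/-- This is the binomial series of `(1 - X) ^ (k - y)`. For `y ≥ k` it is a power of the geometric
series; for `y < k` it is a polynomial of degree less than `n`, and the product contains the factor
zero. -/
theorem prod_range_eq_coeff (y k n : ℕ) (hy : 0 < y) (hk : k < n) :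
    ∏ i ∈ Finset.range n, ((y : ℚ) - k + i) = n.factorial * coeff n (geom ^ y * (1 - X) ^ k) := by
  rcases le_or_gt k y with hky | hky
  · obtain ⟨d, rfl⟩ := Nat.exists_eq_add_of_le hky
    have : geom ^ (k + d) * (1 - X) ^ k = geom ^ d := by
      rw [pow_add, mul_right_comm, ← mul_pow, geom_mul]; simp
    rw [this]
    rcases d with _ | d
    · rw [Finset.prod_eq_zero (Finset.mem_range.2 (by omega : 0 < n)) (by simp)]
      rw [pow_zero, coeff_one, if_neg (by omega), mul_zero]
    · rw [geom, mk_one_pow_eq_mk_choose_add, coeff_mk]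
      have := Nat.ascFactorial_eq_factorial_mul_choose d n
      rw [Nat.ascFactorial_eq_prod_range, ← Nat.choose_symm_add] at this
      rw [← Nat.cast_mul, ← this, Nat.cast_prod]
      exact Finset.prod_congr rfl fun i _ => by push_cast; ring
  · obtain ⟨d, rfl⟩ := Nat.exists_eq_add_of_lt hky
    have : geom ^ y * (1 - X) ^ (y + d + 1) = (1 - X) ^ (d + 1) := by
      rw [add_assoc, pow_add, ← mul_assoc, ← mul_pow, geom_mul]; simp
    rw [this, coeff_one_sub_X_pow_eq_zero (by omega), mul_zero]
    exact Finset.prod_eq_zero (Finset.mem_range.2 (by omega : d + 1 < n)) (by push_cast; ring)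

/-- The binomial theorem for `((2 - X) * X) ^ N = (1 - (1 - X) ^ 2) ^ N`; the factor `X ^ N` shifts
the degree from `2N + 1` to `N + 1`. -/
theorem sum_choose_mul_prod_eq_coeff (N y : ℕ) (hy : 0 < y) :
    ∑ s ∈ Finset.range (N + 1), (N.choose s : ℚ) * (-1) ^ s *
        ∏ i ∈ Finset.range (2 * N + 1), ((y : ℚ) - (2 * s : ℕ) + i)
      = (2 * N + 1).factorial * coeff (N + 1) (geom ^ y * (2 - X) ^ N) := by
  have h1 : (2 - X : ℚ⟦X⟧) ^ N * X ^ N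
      = ∑ s ∈ Finset.range (N + 1), C ((N.choose s : ℚ) * (-1) ^ s) * (1 - X) ^ (2 * s) := by
    rw [← mul_pow, show (2 - X : ℚ⟦X⟧) * X = - (1 - X) ^ 2 + 1 by ring, add_pow]
    refine Finset.sum_congr rfl fun s _ => ?_
    rw [neg_pow, pow_mul]
    simp only [map_mul, map_pow, map_neg, map_one, map_natCast, one_pow]
    ring
  rw [← coeff_mul_X_pow (geom ^ y * (2 - X) ^ N) N (N + 1), mul_assoc, h1, Finset.mul_sum, map_sum,
    Finset.mul_sum, show N + 1 + N = 2 * N + 1 by ring]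
  refine Finset.sum_congr rfl fun s hs => ?_
  rw [prod_range_eq_coeff y (2 * s) (2 * N + 1) hy (by have := Finset.mem_range.1 hs; omega),
    mul_left_comm (geom ^ y), coeff_C_mul]
  ring

/-- Both sides satisfy `a (y + 1) (N + 1) = a y (N + 1) + a y N + a (y + 1) N`, so it suffices to
compare them for `y = 0` and for `N = 0`. -/
theorem two_mul_coeff_geom (y N : ℕ) : 2 * coeff (N + 1) (geom ^ y * (2 - X) ^ N)
    = coeff (N + 1) (geom ^ y * (1 + X) ^ y) := by
  have hF : ∀ y, geom ^ (y + 1) * (1 + X) ^ (y + 1)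
      = geom ^ y * (1 + X) ^ y + geom ^ y * (1 + X) ^ y * X
        + geom ^ (y + 1) * (1 + X) ^ (y + 1) * X := fun y => by
    have : geom ^ (y + 1) * (1 + X) ^ (y + 1) * (1 - X) = geom ^ y * (1 + X) ^ y * (1 + X) := by
      linear_combination geom ^ y * (1 + X) ^ (y + 1) * geom_mul
    linear_combination this
  have hF0 : ∀ y, coeff 0 (geom ^ y * (1 + X) ^ y) = 1 := fun y => by simp [geom]
  have hG : ∀ y, geom ^ (y + 1) = geom ^ y + geom ^ (y + 1) * X := fun y => by
    linear_combination geom ^ y * geom_mul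
  induction y generalizing N with
  | zero =>
    rw [pow_zero, one_mul, pow_zero, one_mul, coeff_one, if_neg (by omega)]
    have : ((2 - X : ℚ⟦X⟧) ^ N) = (((Polynomial.C 2 - Polynomial.X) ^ N : Polynomial ℚ) : ℚ⟦X⟧) := by
      rw [Polynomial.coe_pow, Polynomial.coe_sub, Polynomial.coe_C, Polynomial.coe_X, map_ofNat]
    rw [this, Polynomial.coeff_coe, Polynomial.coeff_eq_zero_of_natDegree_lt, mul_zero]
    refine lt_of_le_of_lt (Polynomial.natDegree_pow_le) ?_
    have : (Polynomial.C 2 - Polynomial.X : Polynomial ℚ).natDegree ≤ 1 := by compute_degree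
    nlinarith
  | succ y ih =>
    induction N with
    | zero =>
      have ih0 := ih 0
      rw [pow_zero, mul_one] at ih0 ⊢
      rw [hF, hG, map_add, coeff_succ_mul_X, mul_add, ih0, map_add, map_add, coeff_succ_mul_X,
        coeff_succ_mul_X, hF0]
      simp [geom]; ring
    | succ N ihN =>
      have key : geom ^ (y + 1) * (2 - X) ^ (N + 1) = geom ^ y * (2 - X) ^ (N + 1)
          + (geom ^ (y + 1) * (2 - X) ^ N + geom ^ y * (2 - X) ^ N) * X := by
        linear_combination (2 - X) ^ (N + 1) * hG y + geom ^ y * X * (2 - X) ^ N * geom_mul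
      rw [key, map_add, coeff_succ_mul_X, map_add, hF, map_add, map_add, coeff_succ_mul_X,
        coeff_succ_mul_X, ← ihN, ← ih N, ← ih (N + 1)]
      ring

end PolygonGluing

/-! ### Powers of the inverse hyperbolic tangent. -/

namespace PolygonGluing

open PowerSeries

/-- The sum over all `L`-tuples of natural numbers with sum `g` of the products of the
`1 / (2 l + 1)`. -/
noncomputable def tupleSum (L g : ℕ) : ℚ :=
  ∑ l ∈ Finset.Nat.antidiagonalTuple L g, 1 / ∏ k : Fin L, (2 * (l k : ℚ) + 1)

theorem tupleSum_zero (g : ℕ) : tupleSum 0 g = if g = 0 then 1 else 0 := by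
  rcases g with _ | g <;> simp [tupleSum]

theorem tupleSum_succ (L g : ℕ) : tupleSum (L + 1) g
    = ∑ z ∈ Finset.HasAntidiagonal.antidiagonal g, 1 / (2 * (z.1 : ℚ) + 1) * tupleSum L z.2 := by
  simp only [tupleSum, Finset.mul_sum]
  rw [Finset.sum_sigma']
  refine Finset.sum_nbij' (fun l => ⟨(l 0, ∑ i : Fin L, l i.succ), fun i => l i.succ⟩)
    (fun z => Fin.cons z.1.1 z.2) ?_ ?_ ?_ ?_ ?_
  · intro l hl
    simp only [Finset.Nat.mem_antidiagonalTuple, Fin.sum_univ_succ] at hl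
    simp [Finset.Nat.mem_antidiagonalTuple, hl]
  · rintro ⟨⟨a, b⟩, l⟩ h
    simp only [Finset.mem_sigma, Finset.HasAntidiagonal.mem_antidiagonal, Finset.Nat.mem_antidiagonalTuple] at h
    simp [Finset.Nat.mem_antidiagonalTuple, Fin.sum_univ_succ, h]
  · intro l _
    exact Fin.cons_self_tail l
  · rintro ⟨⟨a, b⟩, l⟩ h
    simp only [Finset.mem_sigma, Finset.HasAntidiagonal.mem_antidiagonal, Finset.Nat.mem_antidiagonalTuple] at h
    simp [h.2]
  · intro l _
    rw [Fin.prod_univ_succ]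
    simp [mul_comm]

theorem tupleSum_nonneg (L g : ℕ) : 0 ≤ tupleSum L g :=
  Finset.sum_nonneg fun l _ => by positivity

/-- The series `∑ z ^ k / (2 k + 1)`. -/
noncomputable def oddInv : ℚ⟦X⟧ := PowerSeries.mk fun k => 1 / (2 * (k : ℚ) + 1)

/-- The series of the inverse hyperbolic tangent. -/
noncomputable def artanhSeries : ℚ⟦X⟧ := X * expand 2 two_ne_zero oddInv

theorem coeff_oddInv_pow (L g : ℕ) : coeff g (oddInv ^ L) = tupleSum L g := by
  induction L generalizing g with
  | zero => rw [pow_zero, coeff_one, tupleSum_zero]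
  | succ L ih =>
    rw [pow_succ', coeff_mul, tupleSum_succ]
    exact Finset.sum_congr rfl fun z _ => by rw [ih, oddInv, coeff_mk]

theorem coeff_artanhSeries_pow (L g : ℕ) : coeff (L + 2 * g) (artanhSeries ^ L) = tupleSum L g := by
  rw [artanhSeries, mul_pow, ← map_pow, add_comm, coeff_X_pow_mul, coeff_expand_mul, coeff_oddInv_pow]

theorem coeff_artanhSeries_pow_of_lt {L m : ℕ} (h : m < L) : coeff m (artanhSeries ^ L) = 0 := by
  rw [artanhSeries, mul_pow, coeff_X_pow_mul', if_neg (by omega)]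

theorem derivative_artanhSeries : d⁄dX ℚ artanhSeries * (1 - X ^ 2) = 1 := by
  have h : ∀ m, coeff m (d⁄dX ℚ artanhSeries) = if 2 ∣ m then 1 else 0 := by
    intro m
    rw [coeff_derivative, artanhSeries, coeff_succ_X_mul, coeff_expand]
    split_ifs with hm
    · obtain ⟨k, rfl⟩ := hm
      rw [Nat.mul_div_cancel_left _ two_pos, oddInv, coeff_mk]
      push_cast; field_simp
    · simp
  ext m
  rw [mul_sub, mul_one, map_sub, h, coeff_mul_X_pow', coeff_one]
  by_cases hm : 2 ≤ m
  · have : 2 ∣ m ↔ 2 ∣ m - 2 := by omega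
    rw [if_pos hm, h, if_neg (by omega : m ≠ 0)]
    simp only [this, sub_self]
  · rw [if_neg hm, sub_zero]
    exact if_congr (by omega) rfl rfl

/-- Coefficients of `(A ^ L)' * (1 - X ^ 2) = L * A ^ (L - 1)`. The truncated subtractions are
harmless: for `m = 0` and for `L = 0` the factor in front vanishes. -/
theorem artanhSeries_pow_recurrence (L m : ℕ) :
    ((m : ℚ) + 1) * coeff (m + 1) (artanhSeries ^ L)
      = (m - 1 : ℕ) * coeff (m - 1) (artanhSeries ^ L)
        + L * coeff m (artanhSeries ^ (L - 1)) := by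
  have h : d⁄dX ℚ (artanhSeries ^ L) * (1 - X ^ 2) = C (L : ℚ) * artanhSeries ^ (L - 1) := by
    rw [derivative_pow, mul_assoc, derivative_artanhSeries]; simp
  have h2 := congrArg (coeff m) h
  rw [mul_sub, mul_one, map_sub, coeff_C_mul, coeff_mul_X_pow', coeff_derivative] at h2
  rcases m with _ | _ | m
  · simp at h2 ⊢; linarith
  · simp at h2 ⊢; linarith
  · rw [if_pos (by omega), show m + 1 + 1 - 2 = m by omega, coeff_derivative] at h2
    rw [show m + 1 + 1 - 1 = m + 1 by omega]
    push_cast at h2 ⊢; linarith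

theorem derivative_geom_pow_mul (y : ℕ) : d⁄dX ℚ (geom ^ y * (1 + X) ^ y) * (1 - X ^ 2)
    = C (2 * (y : ℚ)) * (geom ^ y * (1 + X) ^ y) := by
  have hg : d⁄dX ℚ geom * (1 - X) = geom := by
    have := congrArg (d⁄dX ℚ) geom_mul
    rw [Derivation.leibniz, smul_eq_mul, smul_eq_mul, map_sub, derivative_X, derivative_one] at this
    linear_combination this
  induction y with
  | zero => simp
  | succ y ih =>
    rw [show geom ^ (y + 1) * (1 + X) ^ (y + 1) = (geom ^ y * (1 + X) ^ y) * (geom * (1 + X)) by ring,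
      Derivation.leibniz (d⁄dX ℚ) (geom ^ y * (1 + X) ^ y) , Derivation.leibniz (d⁄dX ℚ) geom]
    simp only [smul_eq_mul, map_add, derivative_X, derivative_one]
    have e : C (2 * ((y + 1 : ℕ) : ℚ)) = C (2 * (y : ℚ)) + 2 := by
      push_cast; rw [mul_add, map_add, mul_one, map_ofNat C 2]
    rw [e]
    linear_combination (geom * (1 + X)) * ih + (geom ^ y * (1 + X) ^ y) * (1 + X) ^ 2 * hg

theorem coeff_geom_pow_mul_recurrence (y m : ℕ) :
    ((m : ℚ) + 1) * coeff (m + 1) (geom ^ y * (1 + X) ^ y)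
      = (m - 1 : ℕ) * coeff (m - 1) (geom ^ y * (1 + X) ^ y)
        + 2 * y * coeff m (geom ^ y * (1 + X) ^ y) := by
  have h2 := congrArg (coeff m) (derivative_geom_pow_mul y)
  rw [mul_sub, mul_one, map_sub, coeff_C_mul, coeff_mul_X_pow', coeff_derivative] at h2
  rcases m with _ | _ | m
  · simp at h2 ⊢; linarith
  · simp at h2 ⊢; linarith
  · rw [if_pos (by omega), show m + 1 + 1 - 2 = m by omega, coeff_derivative] at h2
    rw [show m + 1 + 1 - 1 = m + 1 by omega]
    push_cast at h2 ⊢; linarith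

theorem sum_artanhSeries_recurrence (y : ℚ) (m : ℕ) :
    (m + 1) * ∑ L ∈ Finset.range (m + 2), (2 * y) ^ L / L.factorial * coeff (m + 1) (artanhSeries ^ L)
      = (m - 1 : ℕ) * ∑ L ∈ Finset.range (m - 1 + 1),
          (2 * y) ^ L / L.factorial * coeff (m - 1) (artanhSeries ^ L)
        + 2 * y * ∑ L ∈ Finset.range (m + 1), (2 * y) ^ L / L.factorial * coeff m (artanhSeries ^ L) := by
  have h1 : ∑ L ∈ Finset.range (m - 1 + 1),
          (2 * y) ^ L / L.factorial * coeff (m - 1) (artanhSeries ^ L)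
      = ∑ L ∈ Finset.range (m + 2), (2 * y) ^ L / L.factorial * coeff (m - 1) (artanhSeries ^ L) := by
    refine Finset.sum_subset (Finset.range_mono (by omega)) fun L _ hL => ?_
    rw [coeff_artanhSeries_pow_of_lt (by simpa using hL), mul_zero]
  have h2 : 2 * y * ∑ L ∈ Finset.range (m + 1), (2 * y) ^ L / L.factorial * coeff m (artanhSeries ^ L)
      = ∑ L ∈ Finset.range (m + 2),
        (2 * y) ^ L / L.factorial * (L * coeff m (artanhSeries ^ (L - 1))) := by
    rw [Finset.sum_range_succ' _ (m + 1), Finset.mul_sum]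
    simp only [Nat.cast_zero, zero_mul, mul_zero, add_zero]
    refine Finset.sum_congr rfl fun L _ => ?_
    rw [Nat.factorial_succ, Nat.add_sub_cancel]
    have : (L.factorial : ℚ) ≠ 0 := by positivity
    push_cast
    field_simp
    ring
  rw [h1, h2, Finset.mul_sum, Finset.mul_sum, ← Finset.sum_add_distrib]
  refine Finset.sum_congr rfl fun L _ => ?_
  rw [mul_left_comm, artanhSeries_pow_recurrence]
  ring

/-- The formal identity `((1 + X) / (1 - X)) ^ y = exp (2 y artanh X)`: both sides solve `(1 - X ^
2) F' = 2 y F` with `F 0 = 1`. The sum over `L` is finite because `artanhSeries ^ L` starts in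
degree `L`. -/
theorem coeff_geom_pow_mul (y m : ℕ) : coeff m (geom ^ y * (1 + X) ^ y)
    = ∑ L ∈ Finset.range (m + 1),
        (2 * (y : ℚ)) ^ L / L.factorial * coeff m (artanhSeries ^ L) := by
  induction m using Nat.strong_induction_on with | _ m ih
  rcases m with _ | m
  · simp [geom]
  · have hm : (m + 1 : ℚ) ≠ 0 := by positivity
    refine mul_left_cancel₀ hm ?_
    rw [coeff_geom_pow_mul_recurrence, sum_artanhSeries_recurrence, ← ih m (by omega),
      ← ih (m - 1) (by omega)]

end PolygonGluing

/-! ### Exchanging the roles of long cycles and pairings. -/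

namespace PolygonGluing

open Equiv Equiv.Perm

theorem isConj_of_forall_sameCycle {α : Type} [Fintype α] [DecidableEq α] {σ τ : Perm α} {x₀ : α}
    (hσ : ∀ x, SameCycle σ x₀ x) (hτ : ∀ x, SameCycle τ x₀ x) : IsConj σ τ := by
  rcases subsingleton_or_nontrivial α with h | h
  · rw [Subsingleton.elim σ τ]
  · have key : ∀ {ρ : Perm α}, (∀ x, SameCycle ρ x₀ x) → IsCycle ρ ∧ ρ.support = Finset.univ := by
      intro ρ hρ
      have hmove : ∀ x, ρ x ≠ x := by
        intro x hx
        obtain ⟨y, hy⟩ := exists_ne x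
        have h1 : SameCycle ρ x y := (hρ x).symm.trans (hρ y)
        obtain ⟨k, hk⟩ := h1
        exact hy (by rw [← hk, zpow_apply_eq_self_of_apply_eq_self hx])
      exact ⟨⟨x₀, hmove _, fun y _ => hρ y⟩, by ext x; simp [hmove x]⟩
    exact (key hσ).1.isConj (key hτ).1 (by rw [(key hσ).2, (key hτ).2])

open Classical in
/-- The permutations with a single cycle are, each of them once, the conjugates of a given one by
the permutations that fix a base point. -/
theorem sum_conj_optionCongr {κ : Type} [Fintype κ] [DecidableEq κ] {R : Type*} [AddCommMonoid R]
    {c : Perm (Option κ)} (hc : ∀ x, SameCycle c none x) (f : Perm (Option κ) → R) :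
    ∑ h : Perm κ, f (optionCongr h * c * (optionCongr h)⁻¹)
      = ∑ w : Perm (Option κ) with ∀ x, SameCycle w none x, f w := by
  refine Finset.sum_bij (fun h _ => optionCongr h * c * (optionCongr h)⁻¹) ?_ ?_ ?_ ?_
  · intro h _
    simp only [Finset.mem_filter, Finset.mem_univ, true_and]
    intro x
    rw [sameCycle_conj]
    exact hc _
  · intro h _ k _ hk
    have hcomm : ∀ x, (optionCongr k)⁻¹ (optionCongr h (c x)) = c ((optionCongr k)⁻¹ (optionCongr h x)) := by
      intro x
      have : (optionCongr k)⁻¹ * optionCongr h * c = c * ((optionCongr k)⁻¹ * optionCongr h) := by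
        calc (optionCongr k)⁻¹ * optionCongr h * c
            = (optionCongr k)⁻¹ * (optionCongr h * c * (optionCongr h)⁻¹) * optionCongr h := by group
          _ = c * ((optionCongr k)⁻¹ * optionCongr h) := by rw [hk]; group
      exact congrArg (fun σ : Perm (Option κ) => σ x) this
    -- The quotient of the two conjugators commutes with `c` and fixes `none`; as `c` is transitive,
    -- it is the identity.
    refine optionCongr_injective (Equiv.ext fun x => ?_)
    obtain ⟨j, rfl⟩ := hc x
    have := zpow_semiconj (σ := c) (τ := c) (fun x => (optionCongr k)⁻¹ (optionCongr h x)) hcomm j none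
    have h0 : (optionCongr k)⁻¹ (optionCongr h none) = none := by
      rw [Perm.inv_eq_iff_eq]; rfl
    simp only [h0] at this
    rw [Perm.inv_eq_iff_eq] at this
    exact this
  · intro w hw
    simp only [Finset.mem_filter, Finset.mem_univ, true_and] at hw
    obtain ⟨π, hπ⟩ := isConj_iff.1 (isConj_of_forall_sameCycle hc hw)
    -- Any conjugator can be corrected by a power of `w`, which commutes with `w`, so that it fixes
    -- `none`.
    obtain ⟨j, hj⟩ := hw (π none)
    have h0 : ((w ^ j)⁻¹ * π) none = none := by
      rw [Perm.mul_apply, ← hj]; simp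
    have h1 : optionCongr (removeNone ((w ^ j)⁻¹ * π)) = (w ^ j)⁻¹ * π := by
      rw [map_equiv_removeNone, h0, swap_self]; rfl
    refine ⟨removeNone ((w ^ j)⁻¹ * π), Finset.mem_univ _, ?_⟩
    rw [h1, mul_inv_rev, inv_inv]
    calc (w ^ j)⁻¹ * π * c * (π⁻¹ * w ^ j) = (w ^ j)⁻¹ * (π * c * π⁻¹) * w ^ j := by group
      _ = w := by rw [hπ]; group
  · intro h _; rfl

/-- The two elements of each pair `{s, p s}` of an involution `p` are labelled by a Boolean. -/
theorem exists_pairing_equiv {κ : Type} [LinearOrder κ] {p : Perm κ} (hp : ∀ s, p (p s) = s) :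
    ∃ e : {s // s < p s} × Bool ≃ {s // p s ≠ s},
      ∀ i b, (e (i, !b) : κ) = p (e (i, b)) := by
  let f : {s // s < p s} × Bool → {s // p s ≠ s} := fun x =>
    if x.2 then ⟨p x.1, by rw [hp]; exact x.1.2.ne⟩ else ⟨x.1, x.1.2.ne'⟩
  have hf1 : ∀ i, (f (i, true) : κ) = p i := fun i => by simp [f]
  have hf0 : ∀ i, (f (i, false) : κ) = i := fun i => by simp [f]
  have hbij : Function.Bijective f := by
    constructor
    · rintro ⟨⟨i, hi⟩, b⟩ ⟨⟨j, hj⟩, c⟩ h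
      have h' := congrArg Subtype.val h
      cases b <;> cases c <;> simp only [hf0, hf1] at h'
      · simp [h']
      · subst h'; rw [hp] at hi; exact absurd hi hj.asymm
      · subst h'; rw [hp] at hj; exact absurd hj hi.asymm
      · simp [p.injective h']
    · rintro ⟨s, hs⟩
      rcases lt_or_gt_of_ne hs with h | h
      · exact ⟨(⟨p s, by rwa [hp]⟩, true), Subtype.ext (by rw [hf1, hp])⟩
      · exact ⟨(⟨s, h⟩, false), Subtype.ext (by rw [hf0])⟩
  refine ⟨Equiv.ofBijective f hbij, fun i b => ?_⟩
  cases b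
  · exact (hf1 i).trans (congrArg p (hf0 i)).symm
  · exact (hf0 i).trans (by rw [Equiv.ofBijective_apply, hf1, hp])

open Classical in
theorem sum_long_matching {N : ℕ} {p : Perm (Fin (2 * N))} (hp : ∀ s, p (p s) = s)
    (hp' : ∀ s, p s ≠ s) {y : ℕ} (hy : 0 < y) :
    ∑ w : Perm (Option (Fin (2 * N))) with ∀ x, SameCycle w none x,
      (y : ℚ) ^ cyc (w * optionCongr p)
      = (2 * N).factorial * PowerSeries.coeff (N + 1) (geom ^ y * (2 - PowerSeries.X) ^ N) := by
  obtain ⟨e₀, he₀⟩ := exists_pairing_equiv hp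
  let e : {s // s < p s} × Bool ≃ Fin (2 * N) := e₀.trans (Equiv.subtypeUnivEquiv hp')
  have he : ∀ i b, e (i, !b) = p (e (i, b)) := fun i b => he₀ i b
  have hcard : Fintype.card {s // s < p s} = N := by
    have := Fintype.card_congr e
    rw [Fintype.card_prod, Fintype.card_bool, Fintype.card_fin] at this
    omega
  have hpos : (0 : ℚ) < y := by exact_mod_cast hy
  have hE : ∀ w : Perm (Option ({s // s < p s} × Bool)),
      cyc (e.optionCongr.permCongr w * optionCongr p) = cyc (w * flipOn Finset.univ) := by
    intro w
    refine (cyc_congr e.optionCongr fun x => ?_).symm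
    rw [Perm.mul_apply, Perm.mul_apply, Equiv.permCongr_apply]
    rcases x with _ | ⟨i, b⟩
    · rfl
    · rw [flipOn_univ_some, show optionCongr p (e.optionCongr (some (i, b)))
        = e.optionCongr (some (i, !b)) from congrArg some (he i b).symm, Equiv.symm_apply_apply]
  have hsum : ∑ w : Perm (Option (Fin (2 * N))) with ∀ x, SameCycle w none x,
      (y : ℚ) ^ cyc (w * optionCongr p) =
      ∑ w : Perm (Option ({s // s < p s} × Bool)) with ∀ x, SameCycle w none x,
        (y : ℚ) ^ cyc (w * flipOn Finset.univ) := by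
    rw [Finset.sum_filter, Finset.sum_filter, ← Equiv.sum_comp e.optionCongr.permCongr]
    refine Finset.sum_congr rfl fun w _ => ?_
    rw [hE]
    refine if_congr ?_ rfl rfl
    rw [← e.optionCongr.forall_congr_right]
    refine forall_congr' fun x => ?_
    exact sameCycle_semiconj_iff (x := none) (σ := w) (τ := e.optionCongr.permCongr w) e.optionCongr e.optionCongr.injective
      (fun x => by rw [Equiv.permCongr_apply, Equiv.symm_apply_apply])
  rw [hsum]
  have h1 := sum_long_flipOn (ι := {s // s < p s}) (y : ℚ)
  have h2 := sum_choose_mul_prod N y hpos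
  rw [sum_choose_mul_prod_eq_coeff N y hy] at h2
  rw [hcard] at h1
  rw [← h1, Nat.factorial_succ] at h2
  push_cast at h2
  refine mul_left_cancel₀ (b := _) (a := (2 * (N : ℚ) + 1) * y) (by positivity) ?_
  linear_combination h2

/-- The pairings of all elements of a type. -/
noncomputable def matchings (κ : Type) [Fintype κ] [DecidableEq κ] : Finset (Perm κ) :=
  Finset.univ.filter fun p => (∀ s, p (p s) = s) ∧ ∀ s, p s ≠ s

theorem mem_matchings {κ : Type} [Fintype κ] [DecidableEq κ] {p : Perm κ} :
    p ∈ matchings κ ↔ (∀ s, p (p s) = s) ∧ ∀ s, p s ≠ s := by simp [matchings]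

/-- Fixed-point-free involutions are the permutations of cycle type `2, …, 2`. For `N = 0` the
truncated `2 * N - 1` is `0`, whose double factorial is `1` as well. -/
theorem card_matchings (N : ℕ) :
    (matchings (Fin (2 * N))).card = (2 * N - 1).doubleFactorial := by
  have h1 : matchings (Fin (2 * N)) = Finset.univ.filter fun p : Perm (Fin (2 * N)) =>
      p.cycleType = Multiset.replicate N 2 := by
    ext p
    rw [mem_matchings, Finset.mem_filter, and_iff_right (Finset.mem_univ p)]
    have hsq : (∀ s, p (p s) = s) ↔ p ^ 2 = 1 := by
      rw [Equiv.ext_iff]; simp [pow_two]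
    have hsupp : (∀ s, p s ≠ s) ↔ p.cycleType.sum = 2 * N := by
      have := Finset.card_eq_iff_eq_univ p.support
      rw [Fintype.card_fin] at this
      rw [sum_cycleType, this, Finset.eq_univ_iff_forall]
      simp
    rw [hsq, hsupp]
    constructor
    · rintro ⟨h2, h3⟩
      have := cycleType_of_pow_prime_eq_one (p := 2) h2
      rw [this] at h3 ⊢
      rw [Multiset.sum_replicate, smul_eq_mul] at h3
      congr 1; omega
    · intro h
      refine ⟨pow_prime_eq_one_iff.2 fun c hc => ?_, ?_⟩
      · rw [h] at hc; exact Multiset.eq_of_mem_replicate hc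
      · rw [h, Multiset.sum_replicate, smul_eq_mul, mul_comm]
  have h2 := card_of_cycleType_mul_eq (Fin (2 * N)) (Multiset.replicate N 2)
  rw [← h1] at h2
  have h3 : ∏ n ∈ (Multiset.replicate N 2).toFinset, ((Multiset.replicate N 2).count n).factorial
      = N.factorial := by
    rcases N with _ | N
    · simp
    · rw [Multiset.toFinset_replicate, if_neg (by omega)]; simp
  rw [h3, if_pos] at h2
  · rw [Multiset.sum_replicate, Multiset.prod_replicate, Fintype.card_fin, smul_eq_mul, mul_comm N 2,
      Nat.sub_self, Nat.factorial_zero, one_mul] at h2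
    have h4 : (2 * N).factorial = (2 * N - 1).doubleFactorial * (2 ^ N * N.factorial) := by
      rcases N with _ | N
      · simp
      · rw [← Nat.doubleFactorial_two_mul, show 2 * (N + 1) = (2 * N + 1) + 1 by ring,
          Nat.factorial_eq_mul_doubleFactorial, Nat.add_sub_cancel, mul_comm]
    rw [h4] at h2
    exact Nat.eq_of_mul_eq_mul_right (by positivity) h2
  · rw [Multiset.sum_replicate, Fintype.card_fin, smul_eq_mul, mul_comm]
    exact ⟨le_rfl, fun a ha => (Multiset.eq_of_mem_replicate ha).ge⟩

/-- Double counting over pairings `p` and conjugates of `c`: for fixed `p` the conjugates run over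
all long cycles, and for a fixed conjugate the sum over `p` does not depend on it. -/
theorem sum_matchings_pow_cyc {N : ℕ} {c : Perm (Option (Fin (2 * N)))}
    (hc : ∀ x, SameCycle c none x) {y : ℕ} (hy : 0 < y) :
    ∑ p ∈ matchings (Fin (2 * N)), (y : ℚ) ^ cyc (c * optionCongr p)
      = (2 * N - 1).doubleFactorial
        * PowerSeries.coeff (N + 1) (geom ^ y * (2 - PowerSeries.X) ^ N) := by
  classical
  have h1 : ∑ p ∈ matchings (Fin (2 * N)), ∑ h : Perm (Fin (2 * N)),
      (y : ℚ) ^ cyc (optionCongr h * c * (optionCongr h)⁻¹ * optionCongr p)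
      = (2 * N - 1).doubleFactorial * ((2 * N).factorial
        * PowerSeries.coeff (N + 1) (geom ^ y * (2 - PowerSeries.X) ^ N)) := by
    rw [← card_matchings, ← nsmul_eq_mul]
    refine Finset.sum_eq_card_nsmul fun p hp => ?_
    obtain ⟨hp1, hp2⟩ := mem_matchings.1 hp
    rw [sum_conj_optionCongr hc fun w => (y : ℚ) ^ cyc (w * optionCongr p),
      sum_long_matching hp1 hp2 hy]
  have h2 : ∀ h : Perm (Fin (2 * N)), ∑ p ∈ matchings (Fin (2 * N)),
      (y : ℚ) ^ cyc (optionCongr h * c * (optionCongr h)⁻¹ * optionCongr p)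
      = ∑ p ∈ matchings (Fin (2 * N)), (y : ℚ) ^ cyc (c * optionCongr p) := by
    intro h
    refine Finset.sum_nbij' (fun p => h⁻¹ * p * h) (fun p => h * p * h⁻¹) ?_ ?_ ?_ ?_ ?_
    · intro p hp
      obtain ⟨hp1, hp2⟩ := mem_matchings.1 hp
      refine mem_matchings.2 ⟨fun s => ?_, fun s hs => ?_⟩
      · simp [hp1]
      · rw [Perm.mul_apply, Perm.mul_apply, Perm.inv_eq_iff_eq] at hs
        exact hp2 _ hs
    · intro p hp
      obtain ⟨hp1, hp2⟩ := mem_matchings.1 hp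
      refine mem_matchings.2 ⟨fun s => ?_, fun s hs => ?_⟩
      · simp [hp1]
      · rw [Perm.mul_apply, Perm.mul_apply, ← Perm.eq_inv_iff_eq] at hs
        exact hp2 _ hs
    · intro p _; group
    · intro p _; group
    · intro p _
      have : optionCongr h * c * (optionCongr h)⁻¹ * optionCongr p = optionCongr h *
          (c * optionCongr (h⁻¹ * p * h)) * (optionCongr h)⁻¹ := by
        have : optionCongr (h⁻¹ * p * h) = (optionCongr h)⁻¹ * optionCongr p * optionCongr h := by
          ext1 x; cases x <;> rfl
        rw [this]; group
      rw [this, cyc_conj]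
  rw [Finset.sum_comm, Finset.sum_congr rfl fun h _ => h2 h, Finset.sum_const, Finset.card_univ,
    Fintype.card_perm, Fintype.card_fin, nsmul_eq_mul] at h1
  have : ((2 * N).factorial : ℚ) ≠ 0 := by positivity
  refine mul_left_cancel₀ this ?_
  linear_combination h1

end PolygonGluing

/-! ### Vertices as cycles, and the closed formula. -/

namespace PolygonGluing

open Equiv Equiv.Perm

/-- The extension of a permutation of `Fin n` to `Fin (n + 1)` that fixes the last element. -/
def extendLast {n : ℕ} (p : Perm (Fin n)) : Perm (Fin (n + 1)) :=
  finSuccEquivLast.symm.permCongr (optionCongr p)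

theorem extendLast_castSucc {n : ℕ} (p : Perm (Fin n)) (s : Fin n) :
    extendLast p s.castSucc = (p s).castSucc := by
  simp [extendLast, Equiv.permCongr_apply]

theorem extendLast_last {n : ℕ} (p : Perm (Fin n)) : extendLast p (Fin.last n) = Fin.last n := by
  simp [extendLast, Equiv.permCongr_apply]

theorem walk_extendLast_castSucc {n : ℕ} (p : Perm (Fin n)) (s : Fin n) :
    walk (extendLast p) s.castSucc = (p s).succ := by
  rw [walk, rot, Perm.mul_apply, extendLast_castSucc, finRotate_apply, Fin.coeSucc_eq_succ]

theorem walk_extendLast_last {n : ℕ} (p : Perm (Fin n)) : walk (extendLast p) (Fin.last n) = 0 := by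
  rw [walk, rot, Perm.mul_apply, extendLast_last, finRotate_last]

theorem card_quot_eq_cyc {α : Type*} {r : α → α → Prop} {σ : Perm α}
    (h1 : ∀ a b, r a b → SameCycle σ a b) (h2 : ∀ a, Quot.mk r a = Quot.mk r (σ a)) :
    Nat.card (Quot r) = cyc σ := by
  refine Nat.card_congr ⟨Quot.lift (Quotient.mk (SameCycle.setoid σ))
    fun a b h => Quotient.sound (s := SameCycle.setoid σ) (h1 a b h),
    Quotient.lift (s := SameCycle.setoid σ) (Quot.mk r)
      fun a b h => SameCycle.map_eq (fun x => (h2 x).symm) h, ?_, ?_⟩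
  · intro x; induction x using Quot.ind; rfl
  · intro x; induction x using Quotient.ind; rfl

/-- The fixed last side is inserted at the distinguished corner, splitting it into the corners `0`
and `2N`. The steps of the walk are then exactly the identifications that define the vertices. -/
theorem card_vertex {N : ℕ} (p : Perm (Fin (2 * N))) :
    Nat.card (Vertex p) = cyc (walk (extendLast p)) := by
  refine card_quot_eq_cyc ?_ ?_
  · rintro a b (⟨rfl, rfl⟩ | ⟨s, rfl, rfl⟩)
    · rw [← walk_extendLast_last p, sameCycle_apply_left]
    · rw [← walk_extendLast_castSucc p, sameCycle_apply_right]
  · intro a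
    induction a using Fin.lastCases with
    | last =>
      rw [walk_extendLast_last]
      refine (Quot.sound ?_).symm
      exact Or.inl ⟨rfl, rfl⟩
    | cast s =>
      rw [walk_extendLast_castSucc]
      refine Quot.sound ?_
      exact Or.inr ⟨s, rfl, rfl⟩

theorem sameCycle_rot (n : ℕ) (x y : Fin (n + 1)) : SameCycle (rot (n + 1)) x y := by
  rcases n with _ | n
  · have : Subsingleton (Fin (0 + 1)) := inferInstanceAs (Subsingleton (Fin 1))
    rw [Subsingleton.elim x y]
  · have hmove : ∀ z : Fin (n + 2), finRotate (n + 2) z ≠ z := fun z => by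
      rw [← mem_support, support_finRotate]; exact Finset.mem_univ _
    exact isCycle_finRotate.sameCycle (hmove x) (hmove y)

theorem sum_matchings_pow_vertex (N : ℕ) {y : ℕ} (hy : 0 < y) :
    ∑ p ∈ matchings (Fin (2 * N)), (y : ℚ) ^ Nat.card (Vertex p)
      = (2 * N - 1).doubleFactorial / 2 * ∑ L ∈ Finset.range (N + 2),
        (2 * (y : ℚ)) ^ L / L.factorial * PowerSeries.coeff (N + 1) (artanhSeries ^ L) := by
  let c : Perm (Option (Fin (2 * N))) := finSuccEquivLast.permCongr (rot (2 * N + 1))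
  have hc : ∀ x, SameCycle c none x := by
    intro x
    obtain ⟨z, rfl⟩ := (finSuccEquivLast (n := 2 * N)).surjective x
    rw [← finSuccEquivLast_last]
    exact sameCycle_of_semiconj finSuccEquivLast
      (fun x => by rw [Equiv.permCongr_apply, Equiv.symm_apply_apply]) (sameCycle_rot _ _ _)
  have h := sum_matchings_pow_cyc hc hy
  have h2 := two_mul_coeff_geom y N
  rw [coeff_geom_pow_mul] at h2
  rw [← h2, show ((2 * N - 1).doubleFactorial : ℚ) / 2 * (2 * PowerSeries.coeff (N + 1)
    (geom ^ y * (2 - PowerSeries.X) ^ N)) = (2 * N - 1).doubleFactorial * PowerSeries.coeff (N + 1)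
    (geom ^ y * (2 - PowerSeries.X) ^ N) by ring, ← h]
  refine Finset.sum_congr rfl fun p _ => ?_
  rw [card_vertex]
  congr 1
  refine cyc_congr finSuccEquivLast fun x => ?_
  simp [c, walk, extendLast, Equiv.permCongr_apply]

/-- The Harer–Zagier numbers. -/
theorem harerZagier_eq {g N : ℕ} (h : 2 * g ≤ N) : (harerZagier g N : ℚ)
    = (2 * N - 1).doubleFactorial / 2 * (2 ^ (N - 2 * g + 1) / (N - 2 * g + 1).factorial
      * tupleSum (N - 2 * g + 1) g) := by
  let P : Polynomial ℚ := ∑ p ∈ matchings (Fin (2 * N)), Polynomial.X ^ Nat.card (Vertex p)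
  let Q : Polynomial ℚ := ∑ L ∈ Finset.range (N + 2),
    Polynomial.C ((2 * N - 1).doubleFactorial / 2 * (2 ^ L / L.factorial
      * PowerSeries.coeff (N + 1) (artanhSeries ^ L))) * Polynomial.X ^ L
  have hPQ : P = Q := by
    -- The cycle sums are known at positive integers `y` only, which is enough to compare the
    -- coefficients of the polynomials.
    refine Polynomial.eq_of_infinite_eval_eq _ _ (Set.Infinite.mono ?_
      ((Set.infinite_range_of_injective (f := fun y : ℕ => ((y + 1 : ℕ) : ℚ))
        (fun a b h => by simpa using h))))
    rintro _ ⟨y, rfl⟩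
    have := sum_matchings_pow_vertex N (Nat.succ_pos y)
    simp only [Set.mem_ofPred_eq, P, Q, Polynomial.eval_finsetSum, Polynomial.eval_pow, Polynomial.eval_X,
      Polynomial.eval_mul, Polynomial.eval_C]
    rw [this, Finset.mul_sum]
    exact Finset.sum_congr rfl fun L _ => by rw [mul_pow]; ring
  have hcoeff := congrArg (fun R : Polynomial ℚ => R.coeff (N - 2 * g + 1)) hPQ
  simp only [P, Q, Polynomial.finsetSum_coeff, Polynomial.coeff_C_mul, Polynomial.coeff_X_pow,
    mul_ite, mul_one, mul_zero, Finset.sum_ite_eq] at hcoeff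
  rw [if_pos (Finset.mem_range.2 (by omega)), ← Finset.sum_filter, Finset.sum_const,
    nsmul_eq_mul, mul_one] at hcoeff
  have hN : N + 1 = N - 2 * g + 1 + 2 * g := by omega
  have hT := coeff_artanhSeries_pow (N - 2 * g + 1) g
  rw [← hN] at hT
  rw [hT] at hcoeff
  rw [← hcoeff, harerZagier, Nat.card_eq_fintype_card, Fintype.card_subtype]
  congr 2
  ext p
  simp only [Finset.mem_filter, Finset.mem_univ, true_and, mem_matchings, and_assoc]
  refine and_congr_right fun _ => and_congr_right fun _ => ?_
  omega

theorem harerZagier_formula {g N : ℕ} (h : 2 * g ≤ N) : (harerZagier g N : ℚ)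
    = 1 / 4 ^ g
      * (((2 * N).factorial : ℚ) / (((N - 2 * g + 1).factorial : ℚ) * (N.factorial : ℚ)))
      * tupleSum (N - 2 * g + 1) g := by
  have h4 : (2 * N).factorial = (2 * N - 1).doubleFactorial * (2 ^ N * N.factorial) := by
    rcases N with _ | N
    · simp
    · rw [← Nat.doubleFactorial_two_mul, show 2 * (N + 1) = (2 * N + 1) + 1 by ring,
        Nat.factorial_eq_mul_doubleFactorial, Nat.add_sub_cancel, mul_comm]
  have h2 : (2 : ℚ) ^ N = 2 ^ (N - 2 * g) * 4 ^ g := by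
    rw [show (4 : ℚ) = 2 ^ 2 by norm_num, ← pow_mul, ← pow_add]; congr 1; omega
  rw [harerZagier_eq h, h4]
  push_cast
  rw [h2, pow_succ]
  have : (N.factorial : ℚ) ≠ 0 := by positivity
  field_simp

end PolygonGluing

/-! ### Convergence of the double series. -/

namespace PolygonGluing

/-- Iterated Cauchy products of the absolutely convergent artanh series. The field is left general
because the real case at `‖x‖` supplies the majorant for the complex one. -/
theorem hasSum_tupleSum_pow {𝕜 : Type*} [RCLike 𝕜] {x a : 𝕜} (hx : ‖x‖ < 1)
    (ha : HasSum (fun k : ℕ => x ^ (2 * k + 1) / (2 * k + 1)) a) (L : ℕ) :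
    Summable (fun g => ‖(tupleSum L g : 𝕜) * x ^ (L + 2 * g)‖) ∧
      HasSum (fun g => (tupleSum L g : 𝕜) * x ^ (L + 2 * g)) (a ^ L) := by
  have ha' : Summable fun k : ℕ => ‖x ^ (2 * k + 1) / (2 * (k : 𝕜) + 1)‖ := by
    refine Summable.of_nonneg_of_le (fun _ => norm_nonneg _) (fun k => ?_)
      (summable_geometric_of_lt_one (norm_nonneg x) hx)
    have h1 : (1 : ℝ) ≤ ‖2 * (k : 𝕜) + 1‖ := by
      have : (2 * (k : 𝕜) + 1) = ((2 * k + 1 : ℕ) : 𝕜) := by push_cast; rfl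
      rw [this, RCLike.norm_natCast]
      exact_mod_cast Nat.succ_le_succ (Nat.zero_le _)
    rw [norm_div, norm_pow]
    calc ‖x‖ ^ (2 * k + 1) / ‖2 * (k : 𝕜) + 1‖ ≤ ‖x‖ ^ (2 * k + 1) :=
          div_le_self (by positivity) h1
      _ ≤ ‖x‖ ^ k := pow_le_pow_of_le_one (norm_nonneg _) hx.le (by omega)
  induction L with
  | zero =>
    have h0 : ∀ g, g ≠ 0 → (tupleSum 0 g : 𝕜) * x ^ (0 + 2 * g) = 0 := fun g hg => by
      rw [tupleSum_zero, if_neg hg]; simp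
    refine ⟨summable_of_ne_finset_zero (s := {0}) fun g hg => ?_, ?_⟩
    · rw [h0 g (by simpa using hg), norm_zero]
    · have := hasSum_single 0 h0
      simpa [tupleSum_zero] using this
  | succ L ih =>
    have hterm : ∀ g, (tupleSum (L + 1) g : 𝕜) * x ^ (L + 1 + 2 * g)
        = ∑ z ∈ Finset.HasAntidiagonal.antidiagonal g, (x ^ (2 * z.1 + 1) / (2 * (z.1 : 𝕜) + 1))
          * ((tupleSum L z.2 : 𝕜) * x ^ (L + 2 * z.2)) := by
      intro g
      rw [tupleSum_succ, Rat.cast_sum, Finset.sum_mul]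
      refine Finset.sum_congr rfl fun z hz => ?_
      rw [← Finset.HasAntidiagonal.mem_antidiagonal.1 hz]
      push_cast
      ring
    have h1 := summable_norm_sum_mul_antidiagonal_of_summable_norm ha' ih.1
    have h2 := tsum_mul_tsum_eq_tsum_sum_antidiagonal_of_summable_norm ha' ih.1
    rw [ha.tsum_eq, ih.2.tsum_eq, ← pow_succ'] at h2
    have h3 : (fun g => (tupleSum (L + 1) g : 𝕜) * x ^ (L + 1 + 2 * g)) = _ := funext hterm
    refine ⟨by simpa only [hterm] using h1, ?_⟩
    rw [h3, h2]
    exact h1.of_norm.hasSum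

/-- Uses `artanh x = i * arctan (-i x)`. -/
theorem hasSum_artanh {x : ℂ} (hx : ‖x‖ < 1) :
    HasSum (fun k : ℕ => x ^ (2 * k + 1) / (2 * k + 1)) (Complex.log ((1 + x) / (1 - x)) / 2) := by
  have h := (Complex.hasSum_arctan (z := -x * Complex.I) (by simpa using hx)).mul_left Complex.I
  have hI : -x * Complex.I * Complex.I = x := by
    rw [mul_assoc, Complex.I_mul_I]; ring
  convert! h using 1
  · ext k
    rw [mul_pow, pow_succ Complex.I, pow_mul Complex.I, Complex.I_sq, neg_pow x,
      pow_succ (-1 : ℂ), pow_mul (-1 : ℂ)]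
    push_cast
    have : Complex.I * Complex.I = -1 := Complex.I_mul_I
    have h2 : ((-1 : ℂ) ^ k) * (-1) ^ k = 1 := by rw [← mul_pow]; simp
    rw [show (-1 : ℂ) ^ 2 = 1 by norm_num, one_pow]
    linear_combination (x ^ (2 * k + 1) / (2 * k + 1)) * ((-1) ^ k * (-1) ^ k * this - h2)
  · rw [Complex.arctan, hI]
    linear_combination (Complex.log ((1 + x) / (1 - x)) / 2) * Complex.I_mul_I

/-- The expansion of `((1 + x) / (1 - x)) ^ y` as an absolutely convergent double series. -/
theorem hasSum_tupleSum_exp {x : ℂ} (hx : ‖x‖ < 1) (y : ℂ) :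
    HasSum (fun z : ℕ × ℕ => (2 * y) ^ z.1 / z.1.factorial
      * ((tupleSum z.1 z.2 : ℂ) * x ^ (z.1 + 2 * z.2)))
      (Complex.exp (y * Complex.log ((1 + x) / (1 - x)))) := by
  set a := Complex.log ((1 + x) / (1 - x)) / 2 with ha
  have hrow := hasSum_tupleSum_pow hx (hasSum_artanh hx)
  obtain ⟨α, hα⟩ : Summable fun k : ℕ => ‖x‖ ^ (2 * k + 1) / (2 * (k : ℝ) + 1) := by
    refine (hasSum_artanh hx).summable.norm.congr fun k => ?_
    have : (2 * (k : ℂ) + 1) = ((2 * k + 1 : ℕ) : ℂ) := by push_cast; rfl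
    rw [norm_div, norm_pow, this, Complex.norm_natCast]
    push_cast; rfl
  have hrow' := hasSum_tupleSum_pow (𝕜 := ℝ) (by simpa using hx) hα
  have hnorm : ∀ L g, ‖(2 * y) ^ L / L.factorial * ((tupleSum L g : ℂ) * x ^ (L + 2 * g))‖
      = ‖2 * y‖ ^ L / L.factorial * ((tupleSum L g : ℝ) * ‖x‖ ^ (L + 2 * g)) := by
    intro L g
    rw [norm_mul (_ / _), norm_div, norm_pow, Complex.norm_natCast, norm_mul (tupleSum L g : ℂ),
      norm_pow, Complex.norm_ratCast,
      abs_of_nonneg (by exact_mod_cast tupleSum_nonneg L g)]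
  have hsumm : Summable (fun z : ℕ × ℕ => (2 * y) ^ z.1 / z.1.factorial
      * ((tupleSum z.1 z.2 : ℂ) * x ^ (z.1 + 2 * z.2))) := by
    refine Summable.of_norm ?_
    refine (summable_prod_of_nonneg fun _ => norm_nonneg _).2 ⟨fun L => ?_, ?_⟩
    · simp only [hnorm]
      exact (hrow' L).2.summable.mul_left _
    · simp only [hnorm]
      -- The norms in row `L` sum to a term of an exponential series.
      have : ∀ L : ℕ, ∑' g, ‖2 * y‖ ^ L / L.factorial * ((tupleSum L g : ℝ) * ‖x‖ ^ (L + 2 * g))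
          = (‖2 * y‖ * α) ^ L / L.factorial := by
        intro L
        rw [((hrow' L).2.mul_left _).tsum_eq, mul_pow]; ring
      simp only [this]
      exact Real.summable_pow_div_factorial _
  have h1 := hsumm.hasSum.prod_fiberwise fun L => (hrow L).2.mul_left ((2 * y) ^ L / L.factorial)
  have h2 : HasSum (fun L : ℕ => (2 * y) ^ L / L.factorial * a ^ L)
      (Complex.exp (y * Complex.log ((1 + x) / (1 - x)))) := by
    have := NormedSpace.expSeries_div_hasSum_exp (2 * y * a)
    rw [← Complex.exp_eq_exp_ℂ] at this
    convert! this using 1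
    · ext L; rw [mul_pow (2 * y) a]; ring
    · congr 1; rw [ha]; ring
  rw [← h1.unique h2]
  exact hsumm.hasSum

theorem hasSum_harerZagier {x : ℂ} (hx : ‖x‖ < 1) (y : ℂ) :
    HasSum (fun p : {p : ℕ × ℕ // 2 * p.1 ≤ p.2} =>
          (harerZagier p.1.1 p.1.2 : ℂ)
            * x ^ (p.1.2 + 1) * y ^ (p.1.2 - 2 * p.1.1 + 1)
            / ((2 * p.1.2 - 1).doubleFactorial : ℂ))
      ((Complex.exp (y * Complex.log ((1 + x) / (1 - x))) - 1) / 2) := by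
  -- The index is `L = N - 2g + 1 ≥ 1`. The row `L = 0` is not reached; its only nonzero entry is
  -- the `1` at `(0, 0)`, subtracted here.
  have h1 := ((hasSum_tupleSum_exp hx y).sub (hasSum_ite_eq ((0, 0) : ℕ × ℕ) (1 : ℂ))).div_const 2
  let e : {p : ℕ × ℕ // 2 * p.1 ≤ p.2} → ℕ × ℕ := fun p => (p.1.2 - 2 * p.1.1 + 1, p.1.1)
  have he : Function.Injective e := by
    rintro ⟨⟨g, N⟩, h⟩ ⟨⟨g', N'⟩, h'⟩ hh
    simp only [e, Prod.mk.injEq, Subtype.mk.injEq] at hh h h' ⊢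
    omega
  rw [← he.hasSum_iff] at h1
  · convert! h1 using 1
    ext ⟨⟨g, N⟩, h⟩
    simp only [e, Function.comp] at h ⊢
    have hd : ((2 * N - 1).doubleFactorial : ℂ) ≠ 0 := by
      exact_mod_cast (Nat.doubleFactorial_pos _).ne'
    have := congrArg (Rat.cast (K := ℂ)) (harerZagier_eq h)
    push_cast at this
    rw [this, if_neg (by simp), show N - 2 * g + 1 + 2 * g = N + 1 by omega, mul_pow]
    field_simp
    ring
  · rintro ⟨L, g⟩ hL
    have hL0 : L = 0 := by
      by_contra hne
      refine hL ⟨⟨(g, L - 1 + 2 * g), by simp⟩, ?_⟩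
      simp only [e, Prod.mk.injEq, and_true]
      omega
    subst hL0
    rcases g with _ | g <;> simp [tupleSum_zero]

end PolygonGluing

/-! ### Gluings with a single unglued side. -/

namespace PolygonGluing

open Equiv Equiv.Perm

theorem two_mul_numPairs_add {M : ℕ} {p : Perm (Fin M)} (hp : ∀ s, p (p s) = s) :
    2 * numPairs p + Nat.card {s // p s = s} = M := by
  obtain ⟨e, -⟩ := exists_pairing_equiv hp
  have h1 := Nat.card_congr e
  rw [Nat.card_prod, Nat.card_eq_fintype_card (α := Bool), Fintype.card_bool] at h1
  have h2 := Nat.card_congr (Equiv.sumCompl fun s => p s = s)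
  rw [Nat.card_sum, Nat.card_eq_fintype_card (α := Fin M), Fintype.card_fin] at h2
  simp only [numPairs, ne_eq] at h1 h2 ⊢
  omega

theorem exists_extendLast_eq {n : ℕ} {σ : Perm (Fin (n + 1))} (h : σ (Fin.last n) = Fin.last n) :
    ∃ p : Perm (Fin n), extendLast p = σ := by
  let τ : Perm (Option (Fin n)) := finSuccEquivLast.permCongr σ
  have hτ : τ none = none := by simp [τ, Equiv.permCongr_apply, h]
  have h1 : optionCongr (removeNone τ) = τ := by
    rw [map_equiv_removeNone, hτ, swap_self]; rfl
  refine ⟨removeNone τ, ?_⟩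
  rw [extendLast, h1]
  ext1 x
  simp [τ, Equiv.permCongr_apply]

theorem extendLast_injective {n : ℕ} : Function.Injective (extendLast (n := n)) := by
  intro p q h
  ext1 s
  have := congrArg (fun σ : Perm (Fin (n + 1)) => σ s.castSucc) h
  simp only [extendLast_castSucc] at this
  exact Fin.castSucc_injective _ this

theorem extendLast_involutive_iff {n : ℕ} (p : Perm (Fin n)) :
    (∀ s, extendLast p (extendLast p s) = s) ↔ ∀ s, p (p s) = s := by
  simp [Fin.forall_fin_succ', extendLast_castSucc, extendLast_last]

theorem extendLast_eq_self_iff {n : ℕ} (p : Perm (Fin n)) :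
    (∀ s, extendLast p s = s ↔ s = Fin.last n) ↔ ∀ s, p s ≠ s := by
  simp [Fin.forall_fin_succ', extendLast_castSucc, extendLast_last, Fin.castSucc_ne_last]

/-- The only letter of a gluing with a single unglued side. -/
def theLetter {L : ℕ} (hL : 1 ≤ L) : Σ i : Fin L, Fin (oneZeros L i) :=
  ⟨⟨0, hL⟩, ⟨0, by simp [oneZeros]⟩⟩

theorem eq_theLetter {L : ℕ} (hL : 1 ≤ L) (x : Σ i : Fin L, Fin (oneZeros L i)) :
    x = theLetter hL := by
  obtain ⟨⟨i, hi⟩, ⟨k, hk⟩⟩ := x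
  have hi0 : i = 0 := by
    by_contra h
    simp [oneZeros, h] at hk
  subst hi0
  have hk0 : k = 0 := by simpa [oneZeros] using hk
  subst hk0
  rfl

theorem card_fixed_of_unglued_iff {M : ℕ} {p : Perm (Fin M)} {a : Fin M}
    (h : ∀ s, p s = s ↔ s = a) : Nat.card {s // p s = s} = 1 := by
  simp only [h]
  exact Nat.card_unique

/-- The polygon gluing with the last side unglued, made from a gluing of all other sides. -/
def gluingOfPairing {g L N : ℕ} (hL : 1 ≤ L) (hN : N = 2 * g + L - 1) (p : Perm (Fin (2 * N)))
    (h1 : ∀ s, p (p s) = s) (h2 : ∀ s, p s ≠ s)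
    (h3 : (Nat.card (Vertex p) : ℤ) - N + 1 = 2 - 2 * g) : Gluing g (oneZeros L) (2 * N + 1) where
  side := extendLast p
  letter _ := Fin.last _
  side_side := (extendLast_involutive_iff p).2 h1
  letter_injective x y _ := (eq_theLetter hL x).trans (eq_theLetter hL y).symm
  unglued_iff s := by
    rw [(extendLast_eq_self_iff p).2 h2]
    exact ⟨fun h => ⟨theLetter hL, h.symm⟩, fun ⟨_, h⟩ => h.symm⟩
  next_letter i k := by
    classical
    have hex : ∃ m : ℕ, 0 < m ∧ (walk (extendLast p) ^ m) (Fin.last _) = Fin.last _ :=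
      ⟨orderOf (walk (extendLast p)), orderOf_pos _, by simp [pow_orderOf_eq_one]⟩
    -- With one letter only, the next unglued side is that side itself, met at the first return of
    -- the walk.
    refine ⟨Nat.find hex, (Nat.find_spec hex).1, (Nat.find_spec hex).2, fun j hj0 hj h => ?_⟩
    rw [(extendLast_eq_self_iff p).2 h2] at h
    exact Nat.find_min hex hj ⟨hj0, h⟩
  card_hole := by
    have := card_vertex p
    change cyc (walk (extendLast p)) = L
    omega
  genus := by
    have h4 := two_mul_numPairs_add ((extendLast_involutive_iff p).2 h1)
    rw [card_fixed_of_unglued_iff ((extendLast_eq_self_iff p).2 h2)] at h4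
    have h5 := card_vertex p
    change ((cyc (walk (extendLast p)) : ℕ) : ℤ) - _ + 1 = _
    omega

theorem cyc_walk_conj {M : ℕ} (p : Perm (Fin M)) (k : ℤ) :
    cyc (walk (rot M ^ k * p * (rot M ^ k)⁻¹)) = cyc (walk p) := by
  rw [← cyc_conj (walk p) (rot M ^ k), walk, walk]
  congr 1
  group

/-- Rotations act freely on the sides, so a rotation that keeps the unglued side in place is
trivial. This makes the normalized representative of a class unique. -/
theorem rot_zpow_eq_one {n : ℕ} {k : ℤ} {a : Fin (n + 1)} (h : (rot (n + 1) ^ k) a = a) :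
    rot (n + 1) ^ k = 1 := by
  ext1 x
  obtain ⟨j, rfl⟩ := sameCycle_rot n a x
  rw [← Perm.mul_apply, ← zpow_add, add_comm k j, zpow_add, Perm.mul_apply, h]; rfl

theorem numGluings_oneZeros {g L : ℕ} (hL : 1 ≤ L) :
    numGluings g (oneZeros L) = harerZagier g (2 * g + L - 1) := by
  obtain ⟨N, hN⟩ : ∃ N, N = 2 * g + L - 1 := ⟨_, rfl⟩
  rw [← hN]
  symm
  refine Nat.card_congr (Equiv.ofBijective (fun p => ⟨2 * N + 1,
    Quotient.mk (Gluing.rotSetoid g (oneZeros L) (2 * N + 1))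
      (gluingOfPairing hL hN p.1 p.2.1 p.2.2.1 p.2.2.2)⟩) ⟨?_, ?_⟩)
  · rintro ⟨p, hp⟩ ⟨q, hq⟩ h
    have h' := Quotient.exact (s := Gluing.rotSetoid g (oneZeros L) (2 * N + 1))
      (eq_of_heq (Sigma.mk.inj h).2)
    obtain ⟨k, hk1, hk2⟩ := h'
    have hk := rot_zpow_eq_one (hk2 (theLetter hL)).symm
    rw [hk, one_mul, inv_one, mul_one] at hk1
    exact Subtype.ext (extendLast_injective hk1.symm)
  · rintro ⟨M, G⟩
    induction G using Quotient.inductionOn with | _ G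
    have hfix : ∀ s, G.side s = s ↔ s = G.letter (theLetter hL) := fun s => by
      rw [G.unglued_iff]
      refine ⟨fun ⟨x, hx⟩ => by rw [← eq_theLetter hL x, hx], fun h => ⟨_, h.symm⟩⟩
    -- The Euler characteristic fixes the number of glued pairs, and one side is unglued.
    have hM : M = 2 * N + 1 := by
      have h1 := two_mul_numPairs_add G.side_side
      rw [card_fixed_of_unglued_iff hfix] at h1
      have h2 := G.genus
      rw [HasGenus, G.card_hole] at h2
      omega
    subst hM
    -- Normalization: `k` rotates the unglued side into the last position.
    obtain ⟨k, hk⟩ := sameCycle_rot (2 * N) (G.letter (theLetter hL)) (Fin.last _)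
    have hlast : ∀ s, (rot (2 * N + 1) ^ k * G.side * (rot (2 * N + 1) ^ k)⁻¹) s = s
        ↔ s = Fin.last _ := by
      intro s
      rw [Perm.mul_apply, Perm.mul_apply, ← Perm.eq_inv_iff_eq, hfix, Perm.inv_eq_iff_eq, hk]
    obtain ⟨p, hp⟩ := exists_extendLast_eq ((hlast _).2 rfl)
    have h1 : ∀ s, p (p s) = s := by
      rw [← extendLast_involutive_iff, hp]
      intro s
      simp [Perm.mul_apply, G.side_side]
    have h2 : ∀ s, p s ≠ s := by
      rw [← extendLast_eq_self_iff, hp]; exact hlast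
    have h3 : (Nat.card (Vertex p) : ℤ) - N + 1 = 2 - 2 * g := by
      rw [card_vertex, hp, cyc_walk_conj, show cyc (walk G.side) = L from G.card_hole]
      omega
    refine ⟨⟨p, h1, h2, h3⟩, ?_⟩
    have : Quotient.mk (Gluing.rotSetoid g (oneZeros L) (2 * N + 1))
        (gluingOfPairing hL hN p h1 h2 h3) = Quotient.mk _ G := by
      refine (Quotient.sound (s := Gluing.rotSetoid g (oneZeros L) (2 * N + 1)) ?_).symm
      refine ⟨k, hp, fun x => ?_⟩
      rw [eq_theLetter hL x, hk]; rfl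
    exact congrArg (Sigma.mk (2 * N + 1)) this

end PolygonGluing

theorem mainTheorem5 :
    (∀ g L : ℕ, 1 ≤ L →
      PolygonGluing.numGluings g (PolygonGluing.oneZeros L)
        = PolygonGluing.harerZagier g (2 * g + L - 1)) ∧
    (∀ g N : ℕ, 2 * g ≤ N →
      (PolygonGluing.harerZagier g N : ℚ)
        = 1 / 4 ^ g
          * (((2 * N).factorial : ℚ) / (((N - 2 * g + 1).factorial : ℚ) * (N.factorial : ℚ)))
          * ∑ l ∈ Finset.Nat.antidiagonalTuple (N - 2 * g + 1) g,
              1 / ∏ k : Fin (N - 2 * g + 1), (2 * (l k : ℚ) + 1)) ∧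
    (∀ x y : ℂ, ‖x‖ < 1 →
      ∃ S : ℂ,
        HasSum (fun p : {p : ℕ × ℕ // 2 * p.1 ≤ p.2} =>
          (PolygonGluing.harerZagier p.1.1 p.1.2 : ℂ)
            * x ^ (p.1.2 + 1) * y ^ (p.1.2 - 2 * p.1.1 + 1)
            / ((2 * p.1.2 - 1).doubleFactorial : ℂ)) S ∧
        1 + 2 * S = ((1 + x) / (1 - x)) ^ y) := by
  refine ⟨fun g L hL => PolygonGluing.numGluings_oneZeros hL,
    fun g N h => PolygonGluing.harerZagier_formula h, fun x y hx =>
    ⟨_, PolygonGluing.hasSum_harerZagier hx y, ?_⟩⟩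
  -- The base of the power is nonzero, so the power is the exponential of the logarithm.
  have h1 : 1 - x ≠ 0 := fun h => by
    rw [← sub_eq_zero.1 h] at hx; simp at hx
  have h2 : 1 + x ≠ 0 := fun h => by
    rw [eq_neg_of_add_eq_zero_right h] at hx; simp at hx
  rw [Complex.cpow_def_of_ne_zero (div_ne_zero h2 h1), mul_comm y]
  ring
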